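/- All fields have characteristic zero. A difference field $(F,\sigma)$ is a field $F$ with a field automorphism $\sigma$; $\mathrm{const}_\sigma F=\{c\in F:\sigma(c)=c\}$. A difference field extension $(F(t),\sigma)$ of $(F,\sigma)$ is a $\Sigma^*$-extension (resp. $\Pi$-extension) if $t$ is transcendental over $F$, $\sigma(t)=t+a$ (resp. $\sigma(t)=a\,t$) for some $a\in F\setminus\{0\}$, and $\mathrm{const}_\sigma F(t)=\mathrm{const}_\sigma F$. A $\Pi\Sigma^*$-extension (resp. $\Sigma^*$-extension) $(F(t_1)\cdots(t_e),\sigma)$ of $(F,\sigma)$, $e\ge 0$, is a finite tower of such $\Pi$- and $\Sigma^*$-extensions (resp. of such $\Sigma^*$-extensions). Let $F=G(t_1)\cdots(t_e)$ be a $\Pi\Sigma^*$-extension of $(G,\sigma)$ with $\sigma(t_i)=a_it_i$ or $\sigma(t_i)=t_i+a_i$. The depth function $\delta=\delta_G:F\to\mathbb{N}_0$ is defined recursively by $\delta(t_i)=\delta(a_i)+1$ and, for $g=g_1/g_2$ with $g_1,g_2\in G[t_1,\dots,t_e]$ coprime, $\delta(g)=\max(\{\delta(t_i): t_i\text{ occurs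 in }g_1\text{ or }g_2\}\cup\{0\})$; in particular $\delta(g)=0$ for $g\in G$. The extension depth of a $\Sigma^*$-extension $F(x_1)\cdots(x_r)$ of $F$ is $\max(0,\delta(x_1),\dots,\delta(x_r))$, the depth being taken over $G$ in the tower $G(t_1)\cdots(t_e)(x_1)\cdots(x_r)$. A $\Sigma^*$-extension $(F(s),\sigma)$ of such an $(F,\sigma)$ with $\sigma(s)=s+f$, $f\in F$, is depth-optimal if there is no $\Sigma^*$-extension $(E,\sigma)$ of $(F,\sigma)$ of extension depth at most $\delta(f)$ containing some $g$ with $\sigma(g)-g=f$. A $\Pi\Sigma^*$-extension $G(t_1)\cdots(t_e)$ of $(G,\sigma)$ is a $\Pi\Sigma^\delta$-extension if each of its $\Sigma^*$-extensions $G(t_1)\cdots(t_{i-1})(t_i)$ of $G(t_1)\cdots(t_{i-1})$ is depth-optimal. **Theorem.** Let $(F,\sigma)$ be a $\Pi\Sigma^\delta$-extension of a difference field $(G,\sigma)$ and $\delta=\delta_G$. Then for all $f,g\in F$ with $\sigma(g)-g=f$, $$\delta(f)\le\delta(g)\le\delta(f)+1 .$$ -/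

import Mathlib

universe u v

namespace DiffField

section Towers

variable (G : Type u) {F : Type v} [Field G] [Field F] [Algebra G F]

/-- The intermediate field `G(t₀, …, t_{i-1})` of the tower `G(t₀)…(t_{n-1})`. -/
noncomputable def stage {n : ℕ} (t : Fin n → F) (i : ℕ) : IntermediateField G F :=
  IntermediateField.adjoin G (t '' {j | (j : ℕ) < i})

/-- The generators `t₀, …, t_{i-1}` as elements of `G(t₀, …, t_{i-1})`. -/
noncomputable def lowerGens {n : ℕ} (t : Fin n → F) (i : Fin n) :
    Fin (i : ℕ) → stage G t i :=
  fun j => ⟨t (Fin.castLE i.isLt.le j),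
    IntermediateField.subset_adjoin G _ ⟨Fin.castLE i.isLt.le j, j.isLt, rfl⟩⟩

variable {G}

/-- `x` is a `Π`-extension of the intermediate field `L`: `x` is transcendental over `L`,
`σ x = a x` with `a ∈ L` nonzero, and `L(x)` has no constants besides those of `L`. -/
def IsPiGen (σ : F ≃+* F) (L : IntermediateField G F) (x : F) : Prop :=
  Transcendental L x ∧ (∃ a ∈ L, a ≠ 0 ∧ σ x = a * x) ∧
    ∀ c ∈ IntermediateField.adjoin L {x}, σ c = c → c ∈ L

/-- `x` is a `Σ*`-extension of the intermediate field `L`: `x` is transcendental over `L`,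
`σ x = x + a` with `a ∈ L` nonzero, and `L(x)` has no constants besides those of `L`. -/
def IsSigmaGen (σ : F ≃+* F) (L : IntermediateField G F) (x : F) : Prop :=
  Transcendental L x ∧ (∃ a ∈ L, a ≠ 0 ∧ σ x = x + a) ∧
    ∀ c ∈ IntermediateField.adjoin L {x}, σ c = c → c ∈ L

/-- The difference field `(F, σ)` is a `ΠΣ*`-extension of the difference field `(G, σG)`, built
as the tower `F = G(t₀)…(t_{n-1})`. -/
structure IsPiSigmaExt (σG : G ≃+* G) (σ : F ≃+* F) {n : ℕ} (t : Fin n → F) : Prop where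
  extends_aut : ∀ c : G, σ (algebraMap G F c) = algebraMap G F (σG c)
  stage_eq_top : stage G t n = ⊤
  isGen : ∀ i : Fin n, IsPiGen σ (stage G t i) (t i) ∨ IsSigmaGen σ (stage G t i) (t i)

/-- The difference field `(F, σ)` is a `Σ*`-extension of the difference field `(G, σG)`, built
as the tower `F = G(t₀)…(t_{n-1})`. -/
structure IsSigmaExt (σG : G ≃+* G) (σ : F ≃+* F) {n : ℕ} (t : Fin n → F) : Prop where
  extends_aut : ∀ c : G, σ (algebraMap G F c) = algebraMap G F (σG c)
  stage_eq_top : stage G t n = ⊤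
  isGen : ∀ i : Fin n, IsSigmaGen σ (stage G t i) (t i)

variable (G)

/-- The variable `t_j` occurs in the numerator or in the denominator of `g`, written as a quotient
of two polynomials in the `t`'s that have no common factor. -/
def Occurs {n : ℕ} (t : Fin n → F) (g : F) (j : Fin n) : Prop :=
  ∃ p q : MvPolynomial (Fin n) G, IsRelPrime p q ∧ MvPolynomial.aeval t q ≠ 0 ∧
    g = MvPolynomial.aeval t p / MvPolynomial.aeval t q ∧ (j ∈ p.vars ∨ j ∈ q.vars)

variable {G}

open Classical in
/-- The element `a ∈ L` with `σ x = x + a` or `σ x = a x`, for a `Σ*`- or `Π`-extension `x`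
of `L`. In the second case `σ x - x = (a - 1) x` is not in `L`: it would force `a = 1`, and then
`x` would be a new constant. -/
noncomputable def shiftCoeff (σ : F ≃+* F) (L : IntermediateField G F) (x : F) : F :=
  if σ x - x ∈ L then σ x - x else σ x / x

variable (G)

open Classical in
/-- The depth over `G` of the generator `t_i`: one more than the depth of its coefficient `a_i`,
which is an element of `G(t₀, …, t_{i-1})`. -/
noncomputable def genDepth (σ : F ≃+* F) {n : ℕ} (t : Fin n → F) (i : Fin n) : ℕ :=
  ((Finset.univ.filter fun j : Fin n =>
      j < i ∧ Occurs G t (shiftCoeff σ (stage G t i) (t i)) j).attach.sup fun j =>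
    genDepth σ t j.1) + 1
termination_by i
decreasing_by exact (Finset.mem_filter.mp j.2).2.1

open Classical in
/-- The depth `δ_G(g)` of an element `g` of `G(t₀)…(t_{n-1})`: the maximum of the depths of the
generators that occur in `g`, and `0` if there are none. -/
noncomputable def depth (σ : F ≃+* F) {n : ℕ} (t : Fin n → F) (g : F) : ℕ :=
  (Finset.univ.filter fun j : Fin n => Occurs G t g j).sup (genDepth G σ t)

/-- The generator `t_i` is depth-optimal if it is a `Σ*`-extension: when `σ t_i = t_i + f`
with `f ∈ H := G(t₀, …, t_{i-1})`, there is no `Σ*`-extension `E = H(s₀)…(s_{r-1})` of `H`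
(with `H` carrying the restriction `τ` of `σ`) of extension depth at most `δ_G(f)` that
contains some `g` with `σ g - g = f`. The depth of `s_j` over `G` is taken in the
tower `E = G(t₀)…(t_{i-1})(s₀)…(s_{r-1})`. -/
def IsDepthOptimalGen (σ : F ≃+* F) {n : ℕ} (t : Fin n → F) (i : Fin n) : Prop :=
  ∀ f : stage G t i, σ (t i) = t i + f →
    ¬ ∃ (E : Type v) (_ : Field E) (_ : Algebra G E) (_ : Algebra (stage G t i) E)
        (_ : IsScalarTower G (stage G t i) E)
        (τ : stage G t i ≃+* stage G t i) (σE : E ≃+* E) (r : ℕ) (s : Fin r → E),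
      (∀ x : stage G t i, (τ x : F) = σ x) ∧
      IsSigmaExt τ σE s ∧
      (∀ j : Fin r,
        genDepth G σE (Fin.append (fun k => algebraMap (stage G t i) E (lowerGens G t i k)) s)
          (Fin.natAdd (i : ℕ) j) ≤ depth G σ t f) ∧
      ∃ g : E, σE g - g = algebraMap (stage G t i) E f

variable {G}

/-- `(F, σ)` with `F = G(t₀)…(t_{n-1})` is a depth-optimal `ΠΣ*`-extension
(a `ΠΣ^δ`-extension) of `(G, σG)`. -/
structure IsPiSigmaDeltaExt (σG : G ≃+* G) (σ : F ≃+* F) {n : ℕ} (t : Fin n → F) : Prop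
    extends IsPiSigmaExt σG σ t where
  depthOptimal : ∀ i : Fin n, IsSigmaGen σ (stage G t i) (t i) → IsDepthOptimalGen G σ t i

end Towers

end DiffField

/-! Let K be the image of G in F and call the depth of a generator its level. The elements of depth
at most d form the subfield generated over K by the generators of level at most d. Since the
coefficient of a generator has smaller depth, σ maps this field into itself, and this is the lower
bound.

For the upper bound, let N(i,k) be the field `nest σ K t lev i k`: at each step all sums available
in F over the previous field are adjoined, together with the generators of the next level and of
index below i. If f has depth d, then g lies in N(n,d+1). It suffices to know that a generator t_j
of level p+1 is transcendental over N(n,p)(t_b : b < j), which is `transcendental_gen_nest`. Then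
generators of level above d+1 can be eliminated from g, highest level first, one at a time.

All constants of F lie in K, so a sum is transcendental over a stable field containing K unless it
belongs to it (`transcendental_of_sub_mem`), and adjoining sums never creates a new solution of σ(y)
= βy (`not_mem_sumClosure`). This settles the case where t_j is a product. If t_j is a sum, then t_j
∈ N(n,p)(t_b : b < j) has to be excluded. The fields with n and those with j are related by
`ShiftClosed`: a solution w of σ(w) - w = a with a in the smaller field lies in the smaller field as
soon as it lies in the larger (`shiftClosed_gen_nest`). So t_j would already lie in N(j,p)(t_b : b <
j), that is, t_j would be redundant.

A redundant t_j needs only finitely many of the sums in N(j,p). They can be chosen independent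
(`GoodList`), and then form, inside F, a Σ*-extension of K(t_b : b < j) of extension depth at most p
that contains t_j. This contradicts depth-optimality (`IsPiSigmaDeltaExt.not_isRedundant`). The
independence uses that the earlier generators are not redundant, hence an induction on j. -/

namespace DiffField

/-! ### Polynomials and denominators in one difference variable -/

section OneVariable

open Polynomial

variable {F : Type v} [Field F]

/-- The subfield `L` is mapped into itself by `σ`. -/
def Stable (σ : F ≃+* F) (L : Subfield F) : Prop :=
  L ≤ L.comap (σ : F →+* F)

/-- The subfield `L(x)`. -/
def adj (L : Subfield F) (x : F) : Subfield F :=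
  L ⊔ Subfield.closure {x}

/-- Solutions in `P` of `β σ(w) - w ∈ S` are already in `S`. -/
def ShiftClosed (σ : F ≃+* F) (β : F) (P S : Subfield F) : Prop :=
  ∀ w ∈ P, β * σ w - w ∈ S → w ∈ S

theorem le_adj (L : Subfield F) (x : F) : L ≤ adj L x := le_sup_left

theorem mem_adj_self (L : Subfield F) (x : F) : x ∈ adj L x :=
  (le_sup_right : _ ≤ adj L x) (Subfield.subset_closure rfl)

theorem adj_le {L M : Subfield F} {x : F} (h : L ≤ M) (hx : x ∈ M) : adj L x ≤ M :=
  sup_le h (Subfield.closure_le.2 (by simpa using hx))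

theorem adj_mono {L M : Subfield F} (h : L ≤ M) (x : F) : adj L x ≤ adj M x :=
  adj_le (h.trans (le_adj _ _)) (mem_adj_self _ _)

theorem adj_eq_self {L : Subfield F} {x : F} (hx : x ∈ L) : adj L x = L :=
  le_antisymm (adj_le le_rfl hx) (le_adj _ _)

theorem mem_adj_iff {L : Subfield F} {x y : F} :
    y ∈ adj L x ↔ ∃ p q : L[X], aeval x q ≠ 0 ∧ aeval x q * y = aeval x p := by
  have h : adj L x = (IntermediateField.adjoin L {x}).toSubfield := by
    apply le_antisymm
    · refine adj_le (fun z hz => ?_) ?_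
      · exact (IntermediateField.adjoin L {x}).algebraMap_mem ⟨z, hz⟩
      · exact IntermediateField.mem_adjoin_simple_self L x
    · have : IntermediateField.adjoin L {x} ≤
          (Subfield.toIntermediateField (adj L x) fun z => le_adj L x z.2) := by
        rw [IntermediateField.adjoin_simple_le_iff]
        exact mem_adj_self L x
      exact this
  rw [h]
  change y ∈ IntermediateField.adjoin L {x} ↔ _
  rw [IntermediateField.mem_adjoin_simple_iff]
  constructor
  · rintro ⟨p, q, rfl⟩
    by_cases hq : aeval x q = 0
    · exact ⟨0, 1, by simp, by simp [hq]⟩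
    · exact ⟨p, q, hq, by field_simp⟩
  · rintro ⟨p, q, hq, h⟩
    exact ⟨p, q, by rw [← h]; field_simp⟩

theorem transcendental_mono {L M : Subfield F} (h : L ≤ M) {x : F} (hx : Transcendental M x) :
    Transcendental L x := by
  intro hL
  exact hx (hL.ringHom_of_comp_eq (Subfield.inclusion h) (RingHom.id F)
    (Subfield.inclusion h).injective rfl)

/-- An equation q(x) y = p(x) over L becomes an identity of polynomials over M. Its coefficient at
the degree of q writes y as a quotient of elements of L. This is the tool by which generators are
eliminated from an element. -/
theorem mem_of_transcendental {L M : Subfield F} (h : L ≤ M) {x y : F}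
    (hx : Transcendental M x) (hy : y ∈ adj L x) (hyM : y ∈ M) : y ∈ L := by
  obtain ⟨p, q, hq, hqp⟩ := mem_adj_iff.1 hy
  let f := Subfield.inclusion h
  have hf : ∀ r : L[X], aeval x (r.map f) = aeval x r := fun r => by
    rw [aeval_def, eval₂_map]; rfl
  have h0 : aeval x (C (⟨y, hyM⟩ : M) * q.map f - p.map f) = 0 := by
    rw [map_sub, map_mul, hf, hf, aeval_C, ← hqp]
    change y * _ - _ = 0
    ring
  have h1 := (transcendental_iff.1 hx) _ h0
  have hq0 : q ≠ 0 := by rintro rfl; simp at hq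
  have h2 := congrArg (fun r => ((coeff r q.natDegree : M) : F)) h1
  simp only [coeff_sub, coeff_C_mul, coeff_map, coeff_zero] at h2
  have h3 : y * (q.leadingCoeff : F) = p.coeff q.natDegree := by
    have : y * (q.leadingCoeff : F) - p.coeff q.natDegree = 0 := h2
    linear_combination this
  have h4 : (q.leadingCoeff : F) ≠ 0 := by simpa using hq0
  rw [← eq_div_iff h4] at h3
  rw [h3]
  exact div_mem (p.coeff _).2 q.leadingCoeff.2

variable {σ : F ≃+* F}

theorem Stable.sup {L M : Subfield F} (hL : Stable σ L) (hM : Stable σ M) : Stable σ (L ⊔ M) :=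
  sup_le (fun _ hx => (le_sup_left : L ≤ L ⊔ M) (hL hx))
    (fun _ hx => (le_sup_right : M ≤ L ⊔ M) (hM hx))

theorem stable_closure {A : Set F} (h : ∀ x ∈ A, σ x ∈ Subfield.closure A) :
    Stable σ (Subfield.closure A) :=
  Subfield.closure_le.2 h

theorem Stable.adj {L : Subfield F} (hL : Stable σ L) {x : F} (hx : σ x ∈ adj L x) :
    Stable σ (adj L x) :=
  sup_le (fun _ hy => le_adj L x (hL hy)) (Subfield.closure_le.2 (by simpa using hx))

theorem Stable.adj_sum {L : Subfield F} (hL : Stable σ L) {x : F} (hx : σ x - x ∈ L) :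
    Stable σ (DiffField.adj L x) :=
  hL.adj (by simpa using add_mem (le_adj L x hx) (mem_adj_self L x))

/-- The restriction of `σ` to a stable subfield. -/
def Stable.hom {L : Subfield F} (hL : Stable σ L) : L →+* L :=
  ((σ : F →+* F).comp L.subtype).codRestrict L fun x => hL x.2

/-- The action of `σ` on polynomials in an element `x` with `σ x = u x + b`. -/
noncomputable def Stable.polyHom {L : Subfield F} (hL : Stable σ L) (u b : L) : L[X] →+* L[X] :=
  (compRingHom (C u * X + C b)).comp (mapRingHom hL.hom)

section PolyHom

variable {L : Subfield F} (hL : Stable σ L) {u b : L}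

theorem Stable.polyHom_apply (p : L[X]) :
    hL.polyHom u b p = (p.map hL.hom).comp (C u * X + C b) := rfl

theorem Stable.aeval_polyHom {x : F} (hx : σ x = u * x + b) (p : L[X]) :
    aeval x (hL.polyHom u b p) = σ (aeval x p) := by
  rw [hL.polyHom_apply, aeval_comp]
  have : aeval x (C u * X + C b) = σ x := by
    simp only [map_add, map_mul, aeval_C, aeval_X, hx]
    rfl
  rw [this, aeval_def, eval₂_map, aeval_def]
  exact (hom_eval₂ p (algebraMap L F) (σ : F →+* F) x).symm

theorem Stable.natDegree_polyHom (hu : u ≠ 0) (p : L[X]) :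
    (hL.polyHom u b p).natDegree = p.natDegree := by
  rw [hL.polyHom_apply, natDegree_comp, natDegree_map, natDegree_linear hu, mul_one]

theorem Stable.leadingCoeff_polyHom (hu : u ≠ 0) (p : L[X]) :
    (hL.polyHom u b p).leadingCoeff = hL.hom p.leadingCoeff * u ^ p.natDegree := by
  rw [hL.polyHom_apply, leadingCoeff_comp (by rw [natDegree_linear hu]; simp), leadingCoeff_map,
    natDegree_map, leadingCoeff_linear hu]

theorem Stable.polyHom_ne_zero (hu : u ≠ 0) {p : L[X]} (hp : p ≠ 0) : hL.polyHom u b p ≠ 0 := by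
  rw [← leadingCoeff_ne_zero, hL.leadingCoeff_polyHom hu]
  exact mul_ne_zero ((_root_.map_ne_zero _).2 (leadingCoeff_ne_zero.2 hp)) (pow_ne_zero _ hu)

theorem Stable.polyHom_C (a : L) : hL.polyHom u b (C a) = C (hL.hom a) := by
  simp [hL.polyHom_apply]

theorem Stable.derivative_polyHom (p : L[X]) :
    derivative (hL.polyHom u b p) = C u * hL.polyHom u b (derivative p) := by
  rw [hL.polyHom_apply, hL.polyHom_apply, derivative_comp, derivative_map]
  simp

theorem Stable.coeff_polyHom_zero (p : L[X]) (n : ℕ) :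
    (hL.polyHom u 0 p).coeff n = hL.hom (p.coeff n) * u ^ n := by
  rw [hL.polyHom_apply, C_0, add_zero, comp_C_mul_X_coeff, coeff_map]

end PolyHom

theorem aeval_ne_zero {L : Subfield F} {x : F} (hx : Transcendental L x) {p : L[X]}
    (hp : p ≠ 0) : aeval x p ≠ 0 :=
  fun h => hp ((transcendental_iff.1 hx) p h)

theorem eq_of_aeval_eq {L : Subfield F} {x : F} (hx : Transcendental L x) {p q : L[X]}
    (h : aeval x p = aeval x q) : p = q :=
  (transcendental_iff_injective.1 hx) h

/-- The denominators of w, up to factors in M, form an ideal of L[X], which is stable under σ by the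
hypothesis on βσ(w) - w. Its monic generator q is therefore multiplied by u^(deg q) under σ. So
q(x), or q(x)/x^(deg q) if x is a product, is a constant, hence in L; thus q is 1 or a power of X,
and in either case it is absorbed by M. -/
theorem exists_denominator {L : Subfield F} (hL : Stable σ L) (hc : ∀ c, σ c = c → c ∈ L)
    {x : F} (hx : Transcendental L x) {u b : L} (hu : u ≠ 0) (hσ : σ x = u * x + b)
    (M : Submonoid L[X]) (hMσ : ∀ p ∈ M, hL.polyHom u b p ∈ M)
    (hub : u = 1 ∨ b = 0 ∧ X ∈ M) {w : F} (hw : w ∈ adj L x) {β : F} (hβL : β ∈ L)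
    (hv : ∃ v ∈ M, ∃ r : L[X], aeval x v * (β * σ w - w) = aeval x r) :
    ∃ s ∈ M, ∃ r : L[X], aeval x s * w = aeval x r := by
  let φ := hL.polyHom u b
  have hφ : ∀ p, aeval x (φ p) = σ (aeval x p) := hL.aeval_polyHom hσ
  let D : Ideal L[X] :=
    { carrier := {q | ∃ s ∈ M, ∃ r : L[X], aeval x (s * q) * w = aeval x r}
      zero_mem' := ⟨1, M.one_mem, 0, by simp⟩
      add_mem' := by
        rintro p q ⟨s, hs, r, hr⟩ ⟨s', hs', r', hr'⟩
        refine ⟨s * s', M.mul_mem hs hs', s' * r + s * r', ?_⟩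
        simp only [map_mul, map_add] at hr hr' ⊢
        rw [← hr, ← hr']; ring
      smul_mem' := by
        rintro p q ⟨s, hs, r, hr⟩
        refine ⟨s, hs, p * r, ?_⟩
        simp only [map_mul, smul_eq_mul] at hr ⊢
        rw [← hr]; ring }
  have hD : ∀ q, q ∈ D ↔ ∃ s ∈ M, ∃ r : L[X], aeval x (s * q) * w = aeval x r := fun _ => Iff.rfl
  have hDφ : ∀ q ∈ D, φ q ∈ D := by
    rintro q ⟨s, hs, r, hr⟩
    obtain ⟨v, hvM, r', hr'⟩ := hv
    -- Apply σ to s q w = r and eliminate σ(w) by means of v (βσ(w) - w) = r'.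
    refine ⟨φ s * v, M.mul_mem (hMσ s hs) hvM, C ⟨β, hβL⟩ * v * φ r - φ s * φ q * r', ?_⟩
    have h1 := congrArg σ hr
    simp only [map_mul, map_sub, hφ, aeval_C] at h1 ⊢
    rw [← h1, ← hr']
    change _ = β * _ * _ - _
    ring
  obtain ⟨p₀, q₀, hq₀, hpq₀⟩ := mem_adj_iff.1 hw
  have hq₀D : q₀ ∈ D := ⟨1, M.one_mem, p₀, by simpa using hpq₀⟩
  obtain ⟨g, hg⟩ := (IsPrincipalIdealRing.principal D).principal
  have hgmem : ∀ p, p ∈ D ↔ g ∣ p := fun p => by rw [hg]; exact Ideal.mem_span_singleton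
  have hg0 : g ≠ 0 := by
    rintro rfl
    have := zero_dvd_iff.1 ((hgmem _).1 hq₀D)
    simp [this] at hq₀
  let q := C g.leadingCoeff⁻¹ * g
  have hqm : q.Monic := by
    have := monic_mul_leadingCoeff_inv hg0
    rwa [mul_comm] at this
  have hqD : q ∈ D := (hgmem _).2 (dvd_mul_left _ _)
  have hqdvd : ∀ p ∈ D, q ∣ p := fun p hp => by
    have : IsUnit (C g.leadingCoeff⁻¹ : L[X]) := by
      simpa using hg0
    exact (this.mul_left_dvd).2 ((hgmem p).1 hp)
  have hφq : φ q = C (u ^ q.natDegree) * q := by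
    obtain ⟨e, he⟩ := hqdvd _ (hDφ q hqD)
    have h1 : (φ q).natDegree = q.natDegree := hL.natDegree_polyHom hu q
    have h0 : φ q ≠ 0 := hL.polyHom_ne_zero hu hqm.ne_zero
    have he0 : e ≠ 0 := by rintro rfl; simp [h0] at he
    have h2 : e.natDegree = 0 := by
      rw [he, natDegree_mul hqm.ne_zero he0] at h1; omega
    have h3 : (φ q).leadingCoeff = u ^ q.natDegree := by
      rw [hL.leadingCoeff_polyHom hu, hqm.leadingCoeff, map_one, one_mul]
    rw [eq_C_of_natDegree_eq_zero h2] at he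
    rw [he, leadingCoeff_mul, hqm.leadingCoeff, one_mul, leadingCoeff_C] at h3
    rw [he, h3, mul_comm]
  have hσq : σ (aeval x q) = (u : F) ^ q.natDegree * aeval x q := by
    rw [← hφ, hφq, map_mul, aeval_C]; simp [Algebra.algebraMap_eq_smul_one]; rfl
  have hone : ∃ s ∈ M, aeval x s = aeval x q := by
    rcases hub with rfl | ⟨rfl, hX⟩
    · have hcq := hc _ (by simpa using hσq)
      have : q = C ⟨_, hcq⟩ := eq_of_aeval_eq hx (by rw [aeval_C]; rfl)
      have hd : q.natDegree = 0 := by rw [this, natDegree_C]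
      have hq1 : q = 1 := hqm.natDegree_eq_zero.1 hd
      exact ⟨1, M.one_mem, by rw [hq1]⟩
    · have hx0 : x ≠ 0 := by
        rintro rfl; exact hx (isAlgebraic_zero)
      have hu' : (u : F) ≠ 0 := by simpa using hu
      have hσx : σ x = u * x := by simpa using hσ
      have hcq := hc (aeval x q / x ^ q.natDegree) (by
        rw [map_div₀, map_pow, hσq, hσx, mul_pow]; field_simp)
      have hCX : ∀ (a : L) (n : ℕ), aeval x (C a * X ^ n) = a * x ^ n := fun a n => by
        rw [map_mul, map_pow, aeval_X, aeval_C]; rfl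
      have : q = C (⟨_, hcq⟩ : L) * X ^ q.natDegree := eq_of_aeval_eq hx
        ((div_mul_cancel₀ (aeval x q) (pow_ne_zero q.natDegree hx0)).symm.trans
          (hCX ⟨_, hcq⟩ q.natDegree).symm)
      have hq1 : q = X ^ q.natDegree := by
        have h5 := congrArg leadingCoeff this
        rw [hqm.leadingCoeff, leadingCoeff_mul, leadingCoeff_C, leadingCoeff_X_pow, mul_one] at h5
        rw [← h5, C_1, one_mul] at this
        exact this
      exact ⟨X ^ q.natDegree, M.pow_mem hX _, by rw [← hq1]⟩
  obtain ⟨s, hs, r, hr⟩ := hqD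
  obtain ⟨s', hs', hs'q⟩ := hone
  exact ⟨s * s', M.mul_mem hs hs', r, by rw [← hr, map_mul, map_mul, hs'q]⟩

end OneVariable

end DiffField

namespace DiffField

/-! ### The equations βσ(w) - w = a in one variable -/

section OneVariable

open Polynomial

variable {F : Type v} [Field F] {σ : F ≃+* F}

section Base

variable {L : Subfield F}

theorem aeval_C_coe (x : F) (a : L) : aeval x (C a) = (a : F) := by
  rw [aeval_C]; rfl

/-- If z is algebraic, its minimal polynomial m is invariant under σ, and so is its derivative m'.
Then m'(z) is a constant, hence in L, and minimality forces m' to equal it. In characteristic zero m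
is then linear, so z ∈ L. -/
theorem transcendental_of_sub_mem [CharZero F] (hL : Stable σ L) (hc : ∀ c, σ c = c → c ∈ L)
    {z : F} (hz : z ∉ L) (hΔ : σ z - z ∈ L) : Transcendental L z := by
  intro halg
  have hint : IsIntegral L z := halg.isIntegral
  set m := minpoly L z with hm
  let b : L := ⟨σ z - z, hΔ⟩
  have hσ : σ z = (1 : L) * z + b := by simp [b]
  let φ := hL.polyHom 1 b
  have hφ : ∀ p, aeval z (φ p) = σ (aeval z p) := hL.aeval_polyHom hσ
  have hmon : m.Monic := minpoly.monic hint
  have hφm : φ m = m := by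
    refine eq_of_monic_of_dvd_of_natDegree_le hmon ?_ (minpoly.dvd L z ?_) ?_
    · rw [Monic, hL.leadingCoeff_polyHom one_ne_zero, hmon.leadingCoeff]; simp
    · rw [hφ, minpoly.aeval, map_zero]
    · rw [hL.natDegree_polyHom one_ne_zero]
  have hφm' : φ (derivative m) = derivative m := by
    have := hL.derivative_polyHom (u := 1) (b := b) m
    rw [show hL.polyHom 1 b m = m from hφm] at this
    rw [C_1, one_mul] at this
    exact this.symm
  have hcm := hc (aeval z (derivative m)) (by rw [← hφ, hφm'])
  have hpos : 0 < m.natDegree := minpoly.natDegree_pos hint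
  have hm' : derivative m = C ⟨_, hcm⟩ := by
    rw [← sub_eq_zero]
    by_contra hne
    have h1 := minpoly.degree_le_of_ne_zero L z hne (by
      rw [map_sub, aeval_C_coe, sub_self])
    have h2 : (derivative m - C (⟨_, hcm⟩ : L)).degree < m.degree := by
      refine (degree_sub_le _ _).trans_lt (max_lt (degree_derivative_lt hmon.ne_zero) ?_)
      exact degree_C_le.trans_lt (natDegree_pos_iff_degree_pos.1 hpos)
    exact absurd h1 (not_le.2 h2)
  have hd : (derivative m).natDegree = m.natDegree - 1 := natDegree_derivative m
  rw [hm', natDegree_C] at hd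
  have h1 : m.natDegree = 1 := by omega
  obtain ⟨y, hy⟩ := minpoly.natDegree_eq_one_iff.1 h1
  exact hz (hy ▸ y.2)

/-- By uniqueness of the minimal polynomial of y, of degree d say, σ multiplies its constant
coefficient by α^d. So y^d divided by that coefficient is a constant. -/
theorem exists_pow_mem_of_not_transcendental (hL : Stable σ L) (hc : ∀ c, σ c = c → c ∈ L)
    {y α : F} (hy : ¬ Transcendental L y) (hy0 : y ≠ 0) (hα : α ∈ L) (hσ : σ y = α * y) :
    ∃ n : ℕ, 0 < n ∧ y ^ n ∈ L := by
  have hint : IsIntegral L y := (not_not.1 hy : IsAlgebraic L y).isIntegral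
  set m := minpoly L y with hm
  let u : L := ⟨α, hα⟩
  have hα0 : α ≠ 0 := by
    rintro rfl
    rw [zero_mul, map_eq_zero_iff σ σ.injective] at hσ
    exact hy0 hσ
  have hu : u ≠ 0 := fun h => hα0 (congrArg Subtype.val h)
  have hσ' : σ y = u * y + (0 : L) := by simpa [u] using hσ
  have hmon : m.Monic := minpoly.monic hint
  let φ := hL.polyHom u 0
  have hφ : ∀ p, aeval y (φ p) = σ (aeval y p) := hL.aeval_polyHom hσ'
  have hφm : C (u ^ m.natDegree)⁻¹ * φ m = m := by
    have hlc : (φ m).leadingCoeff = u ^ m.natDegree := by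
      rw [hL.leadingCoeff_polyHom hu, hmon.leadingCoeff, map_one, one_mul]
    have h0 : φ m ≠ 0 := hL.polyHom_ne_zero hu hmon.ne_zero
    refine eq_of_monic_of_dvd_of_natDegree_le hmon ?_ (minpoly.dvd L y ?_) ?_
    · rw [Monic, leadingCoeff_mul, leadingCoeff_C, hlc]
      exact inv_mul_cancel₀ (pow_ne_zero _ hu)
    · rw [map_mul, hφ, minpoly.aeval, map_zero, mul_zero]
    · rw [natDegree_C_mul (inv_ne_zero (pow_ne_zero _ hu)), hL.natDegree_polyHom hu]
  have hc0 : m.coeff 0 ≠ 0 := minpoly.coeff_zero_ne_zero hint hy0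
  have hc0' : ((m.coeff 0 : L) : F) ≠ 0 := by simpa using hc0
  have h0 := congrArg (fun p => coeff p 0) hφm
  simp only [coeff_C_mul, φ, hL.coeff_polyHom_zero, pow_zero, mul_one] at h0
  have h1 : σ (m.coeff 0 : L) = α ^ m.natDegree * (m.coeff 0 : L) := by
    have h2 := congrArg (fun a : L => (a : F)) h0
    change (α ^ m.natDegree)⁻¹ * σ (m.coeff 0 : L) = (m.coeff 0 : L) at h2
    rwa [inv_mul_eq_iff_eq_mul₀ (pow_ne_zero _ hα0)] at h2
  refine ⟨m.natDegree, minpoly.natDegree_pos hint, ?_⟩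
  have h2 := hc (y ^ m.natDegree / (m.coeff 0 : L)) (by
    rw [map_div₀, map_pow, hσ, h1, mul_pow]; field_simp)
  have h3 := mul_mem h2 (m.coeff 0).2
  rwa [div_mul_cancel₀ _ hc0'] at h3

/-- Here w is a polynomial in x. If its degree were positive, its leading coefficient l would
satisfy βσ(l) = l, so Yl would be a constant and Y would lie in L. -/
theorem mem_of_sum_of_twisted (hL : Stable σ L) (hc : ∀ c, σ c = c → c ∈ L)
    {x : F} (hx : Transcendental L x) (hΔ : σ x - x ∈ L) {Y β : F} (hβ : β ∈ L)
    (hY : σ Y = β * Y) (hYL : Y ∉ L) {w : F} (hw : w ∈ adj L x) (ha : β * σ w - w ∈ L) :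
    w ∈ L := by
  let b : L := ⟨σ x - x, hΔ⟩
  have hσ : σ x = (1 : L) * x + b := by simp [b]
  obtain ⟨s, hs, r, hr⟩ := exists_denominator hL hc hx one_ne_zero hσ ⊥
    (by simp [Submonoid.mem_bot]) (Or.inl rfl) hw hβ
    ⟨1, one_mem _, C ⟨_, ha⟩, by rw [map_one, one_mul, aeval_C_coe]⟩
  rw [Submonoid.mem_bot] at hs
  subst hs
  rw [map_one, one_mul] at hr
  have heq : C (⟨β, hβ⟩ : L) * hL.polyHom 1 b r - r = C ⟨_, ha⟩ := eq_of_aeval_eq hx (by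
    rw [map_sub, map_mul, hL.aeval_polyHom hσ, aeval_C_coe, aeval_C_coe, ← hr])
  by_cases hd : r.natDegree = 0
  · rw [eq_C_of_natDegree_eq_zero hd, aeval_C_coe] at hr
    exact hr ▸ (r.coeff 0).2
  · exfalso
    have h1 := congrArg (fun p => ((coeff p r.natDegree : L) : F)) heq
    have h2 : (hL.polyHom 1 b r).coeff r.natDegree = hL.hom r.leadingCoeff := by
      have := hL.leadingCoeff_polyHom (u := 1) (b := b) one_ne_zero r
      rwa [leadingCoeff, hL.natDegree_polyHom one_ne_zero, one_pow, mul_one] at this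
    simp only [coeff_sub, coeff_C_mul, h2, coeff_C, if_neg hd] at h1
    have h3 : β * σ r.leadingCoeff - r.leadingCoeff = 0 := h1
    have hlc : (r.leadingCoeff : F) ≠ 0 := by
      have : r ≠ 0 := by rintro rfl; simp at hd
      simpa using this
    have h4 := hc (Y * r.leadingCoeff) (by
      rw [map_mul, hY]; linear_combination Y * h3)
    apply hYL
    have h5 := div_mem h4 r.leadingCoeff.2
    rwa [mul_div_cancel_right₀ _ hlc] at h5

/-- Again w = r(x) for a polynomial r. Differentiation removes σ(w) - w ∈ L, so r'(x) is a constant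
of F and r is linear. -/
theorem eq_linear_of_sum [CharZero F] (hL : Stable σ L) (hc : ∀ c, σ c = c → c ∈ L)
    {x : F} (hx : Transcendental L x) (hΔ : σ x - x ∈ L) {w : F} (hw : w ∈ adj L x)
    (ha : σ w - w ∈ L) : ∃ c ∈ L, ∃ l ∈ L, σ c = c ∧ w = c * x + l := by
  let b : L := ⟨σ x - x, hΔ⟩
  have hσ : σ x = (1 : L) * x + b := by simp [b]
  obtain ⟨s, hs, r, hr⟩ := exists_denominator hL hc hx one_ne_zero hσ ⊥
    (by simp [Submonoid.mem_bot]) (Or.inl rfl) hw (one_mem L)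
    ⟨1, one_mem _, C ⟨_, ha⟩, by rw [map_one, one_mul, aeval_C_coe, one_mul]⟩
  rw [Submonoid.mem_bot] at hs
  subst hs
  rw [map_one, one_mul] at hr
  have hφ : ∀ p, aeval x (hL.polyHom 1 b p) = σ (aeval x p) := hL.aeval_polyHom hσ
  have heq : hL.polyHom 1 b r - r = C ⟨_, ha⟩ := eq_of_aeval_eq hx (by
    rw [map_sub, hφ, aeval_C_coe, ← hr])
  have h1 := congrArg derivative heq
  rw [derivative_sub, derivative_C, hL.derivative_polyHom, C_1, one_mul, sub_eq_zero] at h1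
  have hσc : σ (aeval x (derivative r)) = aeval x (derivative r) := by rw [← hφ, h1]
  have hcL := hc _ hσc
  have h2 : derivative r = C ⟨_, hcL⟩ := eq_of_aeval_eq hx (by rw [aeval_C_coe])
  have h3 : derivative (r - C ⟨_, hcL⟩ * X) = 0 := by
    rw [derivative_sub, derivative_C_mul, derivative_X, mul_one, ← h2, sub_self]
  have h4 := eq_C_of_natDegree_eq_zero (derivative_eq_zero.1 h3)
  have h5 := congrArg (aeval x) h4
  rw [map_sub, map_mul, aeval_C_coe, aeval_X, aeval_C_coe, ← hr] at h5
  exact ⟨_, hcL, _, (coeff (r - C (⟨_, hcL⟩ : L) * X) 0).2, hσc, by rw [← h5]; ring⟩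

/-- Here w is a Laurent polynomial in x. A nonzero coefficient c at x^e with e ≠ 0 would make Y x^e
c a constant, contrary to `hYL`. -/
theorem mem_of_prod_of_twisted (hL : Stable σ L) (hc : ∀ c, σ c = c → c ∈ L)
    {x α : F} (hx : Transcendental L x) (hα : α ∈ L) (hσx : σ x = α * x) {Y β : F} (hβ : β ∈ L)
    (hY : σ Y = β * Y) (hYL : ∀ e : ℤ, e ≠ 0 → Y * x ^ e ∉ L) {w : F} (hw : w ∈ adj L x)
    (ha : β * σ w - w ∈ L) : w ∈ L := by
  have hx0 : x ≠ 0 := by rintro rfl; exact hx isAlgebraic_zero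
  have hα0 : α ≠ 0 := by
    rintro rfl
    rw [zero_mul, map_eq_zero_iff σ σ.injective] at hσx
    exact hx0 hσx
  let u : L := ⟨α, hα⟩
  have hu : u ≠ 0 := fun h => hα0 (congrArg Subtype.val h)
  have hσ : σ x = u * x + (0 : L) := by simpa [u] using hσx
  have hφX : ∀ n : ℕ, hL.polyHom u 0 (X ^ n) = C (u ^ n) * X ^ n := fun n => by
    simp [hL.polyHom_apply, mul_pow]
  let M : Submonoid L[X] :=
    { carrier := {p | ∃ (a : L) (n : ℕ), a ≠ 0 ∧ p = C a * X ^ n}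
      one_mem' := ⟨1, 0, one_ne_zero, by simp⟩
      mul_mem' := by
        rintro _ _ ⟨a, n, h, rfl⟩ ⟨a', n', h', rfl⟩
        exact ⟨a * a', n + n', mul_ne_zero h h', by rw [C_mul, pow_add]; ring⟩ }
  obtain ⟨s, hs, r, hr⟩ := exists_denominator hL hc hx hu hσ M
    (by
      rintro _ ⟨a, n, h, rfl⟩
      refine ⟨hL.hom a * u ^ n, n, mul_ne_zero ((_root_.map_ne_zero _).2 h) (pow_ne_zero _ hu), ?_⟩
      rw [map_mul, hφX, hL.polyHom_C, C_mul]; ring)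
    (Or.inr ⟨rfl, 1, 1, one_ne_zero, by simp⟩) hw hβ
    ⟨1, one_mem _, C ⟨_, ha⟩, by rw [map_one, one_mul, aeval_C_coe]⟩
  obtain ⟨a, n, ha0, rfl⟩ := hs
  have ha0' : (a : F) ≠ 0 := by simpa using ha0
  obtain ⟨r, rfl⟩ : ∃ r', r = C a * r' := ⟨C a⁻¹ * r, by
    rw [← mul_assoc, ← C_mul, mul_inv_cancel₀ ha0, C_1, one_mul]⟩
  rw [map_mul, map_mul, aeval_C_coe, map_pow, aeval_X, mul_assoc] at hr
  replace hr := mul_left_cancel₀ ha0' hr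
  have hσr : σ (aeval x r) = α ^ n * x ^ n * σ w := by
    rw [← hr, map_mul, map_pow, hσx, mul_pow]
  have heq : C (⟨β, hβ⟩ : L) * hL.polyHom u 0 r - C (u ^ n) * r = C (u ^ n * ⟨_, ha⟩) * X ^ n :=
    eq_of_aeval_eq hx (by
      rw [map_sub, map_mul, map_mul, map_mul, hL.aeval_polyHom hσ, aeval_C_coe,
        aeval_C_coe, aeval_C_coe, map_pow, aeval_X, hσr, ← hr]
      change β * _ - α ^ n * _ = α ^ n * (β * σ w - w) * _
      ring)
  have hcoeff : ∀ j, j ≠ n → r.coeff j = 0 := by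
    intro j hj
    by_contra hne
    have hne' : ((r.coeff j : L) : F) ≠ 0 := by simpa using hne
    have h1 := congrArg (fun p => ((coeff p j : L) : F)) heq
    simp only [coeff_sub, coeff_C_mul, hL.coeff_polyHom_zero, coeff_X_pow, if_neg hj] at h1
    have h2 : β * (σ (r.coeff j : L) * α ^ j) - α ^ n * (r.coeff j : L) = 0 := by
      rw [mul_zero] at h1; exact h1
    have h3 := hc (Y * x ^ ((j : ℤ) - n) * (r.coeff j : L)) (by
      rw [map_mul, map_mul, map_zpow₀, hY, hσx, mul_zpow, zpow_sub₀ hα0, zpow_sub₀ hx0]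
      simp only [zpow_natCast]
      field_simp
      linear_combination Y * h2)
    have h4 := div_mem h3 (r.coeff j).2
    rw [mul_div_cancel_right₀ _ hne'] at h4
    exact hYL _ (by omega) h4
  have hrn : r = C (r.coeff n) * X ^ n := by
    ext j
    rw [coeff_C_mul, coeff_X_pow]
    by_cases hj : j = n
    · simp [hj]
    · simp [hj, hcoeff j hj]
  rw [hrn, map_mul, aeval_C_coe, map_pow, aeval_X, mul_comm] at hr
  rw [mul_right_cancel₀ (pow_ne_zero n hx0) hr]
  exact (r.coeff n).2

end Base

theorem ShiftClosed.adj_sum_left {L S : Subfield F} (hL : Stable σ L)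
    (hc : ∀ c, σ c = c → c ∈ L) (hSL : S ≤ L) {x Y β : F} (hx : Transcendental L x)
    (hΔ : σ x - x ∈ L) (hβ : β ∈ L) (hY : σ Y = β * Y) (hYL : Y ∉ L)
    (h : ShiftClosed σ β L S) : ShiftClosed σ β (adj L x) S :=
  fun w hw ha => h w (mem_of_sum_of_twisted hL hc hx hΔ hβ hY hYL hw (hSL ha)) ha

theorem ShiftClosed.adj_prod_left {L S : Subfield F} (hL : Stable σ L)
    (hc : ∀ c, σ c = c → c ∈ L) (hSL : S ≤ L) {x α Y β : F} (hx : Transcendental L x)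
    (hα : α ∈ L) (hσx : σ x = α * x) (hβ : β ∈ L) (hY : σ Y = β * Y)
    (hYL : ∀ e : ℤ, e ≠ 0 → Y * x ^ e ∉ L)
    (h : ShiftClosed σ β L S) : ShiftClosed σ β (adj L x) S :=
  fun w hw ha => h w (mem_of_prod_of_twisted hL hc hx hα hσx hβ hY hYL hw (hSL ha)) ha

/-- Write w = r/s with s over S, using `exists_denominator` with the nonzero polynomials over S as
admissible denominators. Let l and c be the leading coefficients of r and s, and e = deg r - deg s.
The top coefficient of the cleared equation shows u^e σ(l/c) - l/c ∈ S, whence l ∈ S. The leading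
term of r can then be removed. This is where twists by all powers of u enter, even though the
conclusion has none. -/
theorem ShiftClosed.adj_adj {P S : Subfield F} (hP : Stable σ P) (hS : Stable σ S)
    (hc : ∀ c, σ c = c → c ∈ P) (hSP : S ≤ P) {x u b : F} (hx : Transcendental P x)
    (hu : u ∈ S) (hb : b ∈ S) (hu0 : u ≠ 0) (hσx : σ x = u * x + b) (hub : u = 1 ∨ b = 0)
    (h : ∀ e : ℤ, ShiftClosed σ (u ^ e) P S) : ShiftClosed σ 1 (adj P x) (adj S x) := by
  intro w hw ha
  let i := Subfield.inclusion hSP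
  let uS : S := ⟨u, hu⟩
  let bS : S := ⟨b, hb⟩
  have huS : uS ≠ 0 := fun h => hu0 (congrArg Subtype.val h)
  have huP : i uS ≠ 0 := (_root_.map_ne_zero i).2 huS
  let φ := hP.polyHom (i uS) (i bS)
  have hσ : σ x = i uS * x + i bS := hσx
  have hφ : ∀ p, aeval x (φ p) = σ (aeval x p) := hP.aeval_polyHom hσ
  have hmap : ∀ p : S[X], aeval x (p.map i) = aeval x p := fun p => by
    rw [aeval_def, eval₂_map]; rfl
  have hφmap : ∀ p : S[X], φ (p.map i) = (hS.polyHom uS bS p).map i := fun p => by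
    rw [hS.polyHom_apply, Polynomial.map_comp, map_map]
    change (((p.map i).map hP.hom).comp _) = _
    rw [map_map, Polynomial.map_add, Polynomial.map_mul, map_C, map_C, map_X]
    rfl
  let R : Subring P[X] := (mapRingHom i).range
  have hR : ∀ p, p ∈ R ↔ ∃ q : S[X], q.map i = p := fun _ => Iff.rfl
  have hRφ : ∀ p ∈ R, φ p ∈ R := by
    rintro _ ⟨q, rfl⟩
    exact ⟨_, (hφmap q).symm⟩
  have hinj : Function.Injective (mapRingHom i) := map_injective i i.injective
  obtain ⟨n, m, hm, hmn⟩ := mem_adj_iff.1 ha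
  have hm0 : m ≠ 0 := by rintro rfl; simp at hm
  let M : Submonoid P[X] :=
    { carrier := {p | ∃ q : S[X], q ≠ 0 ∧ q.map i = p}
      one_mem' := ⟨1, one_ne_zero, by simp⟩
      mul_mem' := by
        rintro _ _ ⟨q, h, rfl⟩ ⟨q', h', rfl⟩
        exact ⟨q * q', mul_ne_zero h h', by simp⟩ }
  obtain ⟨_, ⟨s, hs0, rfl⟩, r, hr⟩ := exists_denominator hP hc hx huP hσ M
    (by
      rintro _ ⟨q, h, rfl⟩
      exact ⟨_, hS.polyHom_ne_zero huS h, (hφmap q).symm⟩)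
    (by
      rcases hub with h | h
      · exact Or.inl (Subtype.ext h)
      · exact Or.inr ⟨Subtype.ext h, X, X_ne_zero, by simp⟩) hw (one_mem P)
    ⟨m.map i, ⟨m, hm0, rfl⟩, n.map i, by rw [hmap, hmap, hmn]⟩
  have hkey : m.map i * (φ r * s.map i - r * φ (s.map i)) ∈ R := by
    refine ⟨n * s * hS.polyHom uS bS s, ?_⟩
    change map i _ = _
    rw [Polynomial.map_mul, Polynomial.map_mul, ← hφmap]
    apply eq_of_aeval_eq hx
    simp only [map_mul, map_sub, hφ, hmap] at hr ⊢
    rw [← hr, ← hmn, map_mul]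
    ring
  -- Induction on the number of terms of r; the condition on r is additive, so it survives the
  -- removal of a term with coefficient in S.
  have hmain : ∀ (k : ℕ) (r : P[X]), r.support.card = k →
      m.map i * (φ r * s.map i - r * φ (s.map i)) ∈ R → r ∈ R := by
    intro k
    induction k with
    | zero =>
      intro r hr _
      rw [Finset.card_eq_zero, support_eq_empty] at hr
      rw [hr]; exact zero_mem _
    | succ k ih =>
      intro r hrk hkey
      have hr0 : r ≠ 0 := by rintro rfl; simp at hrk
      have hlc : r.leadingCoeff ∈ i.range := by
        obtain ⟨g, hg⟩ := hkey
        have h1 := congrArg (fun p => coeff p (m.natDegree + (r.natDegree + s.natDegree))) hg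
        have hsi : (s.map i).natDegree = s.natDegree := natDegree_map i
        have hφs : (φ (s.map i)).natDegree = s.natDegree :=
          (hP.natDegree_polyHom huP _).trans hsi
        have hφr : (φ r).natDegree = r.natDegree := hP.natDegree_polyHom huP _
        simp only [coe_mapRingHom] at h1
        rw [coeff_mul_add_eq_of_natDegree_le (natDegree_map_le) (by
          refine (natDegree_sub_le _ _).trans (max_le ?_ ?_)
          · exact natDegree_mul_le.trans (by rw [hsi, hφr])
          · exact natDegree_mul_le.trans (by rw [hφs])), coeff_sub,
          coeff_mul_add_eq_of_natDegree_le hφr.le hsi.le,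
          coeff_mul_add_eq_of_natDegree_le le_rfl hφs.le] at h1
        have h2 : (φ r).coeff r.natDegree = hP.hom r.leadingCoeff * (i uS) ^ r.natDegree := by
          have := hP.leadingCoeff_polyHom (u := i uS) (b := i bS) huP r
          rwa [leadingCoeff, hP.natDegree_polyHom huP] at this
        have h3 : (φ (s.map i)).coeff s.natDegree
            = hP.hom (i s.leadingCoeff) * (i uS) ^ s.natDegree := by
          have := hP.leadingCoeff_polyHom (u := i uS) (b := i bS) huP (s.map i)
          rwa [leadingCoeff, hP.natDegree_polyHom huP, hsi, leadingCoeff_map] at this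
        rw [h2, h3, coeff_map, coeff_map, coeff_map] at h1
        set l : P := r.leadingCoeff
        set c : S := s.leadingCoeff
        set μ : S := m.leadingCoeff
        have hc0 : (c : F) ≠ 0 := by simpa [c] using hs0
        have hμ0 : (μ : F) ≠ 0 := by simpa [μ] using hm0
        set γ : S := coeff g (m.natDegree + (r.natDegree + s.natDegree))
        have h4 : (γ : F) = μ * (σ l * u ^ r.natDegree * c - l * (σ c * u ^ s.natDegree)) :=
          congrArg (fun a : P => (a : F)) h1
        have hσc0 : σ c ≠ 0 := (map_ne_zero_iff σ σ.injective).2 hc0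
        have hσcS : σ c ∈ S := hS c.2
        have h5 : u ^ ((r.natDegree : ℤ) - s.natDegree) * σ ((l : F) / c) - (l : F) / c
            = γ / (μ * (u ^ s.natDegree * (c * σ c))) := by
          rw [h4, zpow_sub₀ hu0, map_div₀]
          simp only [zpow_natCast]
          field_simp
        have h6 := h ((r.natDegree : ℤ) - s.natDegree) ((l : F) / c)
          (div_mem l.2 (hSP c.2)) (by
            rw [h5]
            exact div_mem γ.2 (mul_mem μ.2 (mul_mem (pow_mem hu _) (mul_mem c.2 hσcS))))
        have h7 := mul_mem h6 c.2
        rw [div_mul_cancel₀ _ hc0] at h7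
        exact ⟨⟨l, h7⟩, rfl⟩
      obtain ⟨l, hl⟩ := hlc
      have hmon : monomial r.natDegree r.leadingCoeff ∈ R :=
        ⟨monomial r.natDegree l, by rw [coe_mapRingHom, map_monomial, hl]⟩
      have hre : r.eraseLead = r - monomial r.natDegree r.leadingCoeff :=
        (self_sub_monomial_natDegree_leadingCoeff r).symm
      have h1 : r.eraseLead ∈ R := by
        refine ih _ ?_ ?_
        · exact card_support_eraseLead' hrk
        · have hmm : m.map i ∈ R := ⟨m, rfl⟩
          have hsm : s.map i ∈ R := ⟨s, rfl⟩
          have := R.sub_mem hkey (R.mul_mem hmm (R.sub_mem (R.mul_mem (hRφ _ hmon) hsm)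
            (R.mul_mem hmon (hRφ _ hsm))))
          convert this using 1
          rw [hre, map_sub]
          ring
      rw [← eraseLead_add_monomial_natDegree_leadingCoeff r]
      exact R.add_mem h1 hmon
  obtain ⟨r', rfl⟩ := hmain _ r rfl hkey
  refine mem_adj_iff.2 ⟨r', s, ?_, ?_⟩
  · exact aeval_ne_zero (transcendental_mono hSP hx) hs0
  · rw [← hmap, hr]
    exact hmap r'

end OneVariable

end DiffField

namespace DiffField

/-! ### Closure under sums -/

section SumClosure

variable {F : Type v} [Field F] {σ : F ≃+* F}

theorem exists_maximal_subfield (p : Subfield F → Prop)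
    (hp : ∀ c : Set (Subfield F), c.Nonempty → DirectedOn (· ≤ ·) c → (∀ M ∈ c, p M) → p (sSup c))
    {L : Subfield F} (hL : p L) : ∃ M, L ≤ M ∧ Maximal p M := by
  refine zorn_le_nonempty₀ {M | p M} (fun c hc hchain y hy => ?_) L hL
  exact ⟨sSup c, hp c ⟨y, hy⟩ hchain.directedOn hc, fun z hz => le_sSup hz⟩

theorem stable_sSup {c : Set (Subfield F)} (h : ∀ M ∈ c, Stable σ M) : Stable σ (sSup c) :=
  sSup_le fun M hM _ hx => (le_sSup hM : M ≤ sSup c) (h M hM hx)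

variable (σ) in
/-- `M` contains all sums in `F` of its elements. -/
def SumClosed (M : Subfield F) : Prop :=
  ∀ z, σ z - z ∈ M → z ∈ M

variable (σ) in
/-- The smallest stable and sum-closed subfield containing `L`. -/
def sumClosure (L : Subfield F) : Subfield F :=
  sInf {M | L ≤ M ∧ Stable σ M ∧ SumClosed σ M}

theorem le_sumClosure (L : Subfield F) : L ≤ sumClosure σ L :=
  le_sInf fun _ hM => hM.1

theorem sumClosure_le {L M : Subfield F} (h : L ≤ M) (hM : Stable σ M) (hM' : SumClosed σ M) :
    sumClosure σ L ≤ M :=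
  sInf_le ⟨h, hM, hM'⟩

theorem stable_sumClosure (L : Subfield F) : Stable σ (sumClosure σ L) := by
  intro x hx
  exact Subfield.mem_sInf.2 fun M hM => hM.2.1 (Subfield.mem_sInf.1 hx M hM)

theorem sumClosed_sumClosure (L : Subfield F) : SumClosed σ (sumClosure σ L) := by
  intro x hx
  exact Subfield.mem_sInf.2 fun M hM => hM.2.2 x (Subfield.mem_sInf.1 hx M hM)

theorem sumClosure_le_sumClosure {L M : Subfield F} (h : L ≤ sumClosure σ M) :
    sumClosure σ L ≤ sumClosure σ M :=
  sumClosure_le h (stable_sumClosure M) (sumClosed_sumClosure M)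

theorem sumClosure_mono {L M : Subfield F} (h : L ≤ M) : sumClosure σ L ≤ sumClosure σ M :=
  sumClosure_le_sumClosure (h.trans (le_sumClosure M))

/-- By Zorn there is a maximal stable field with the property between L and its sum closure. It is
sum-closed, because otherwise one more sum could be adjoined. -/
theorem sumClosure_induction {L : Subfield F} (hL : Stable σ L) (p : Subfield F → Prop)
    (hp : ∀ c : Set (Subfield F), c.Nonempty → DirectedOn (· ≤ ·) c → (∀ M ∈ c, p M) → p (sSup c))
    (hpL : p L)
    (hstep : ∀ M, L ≤ M → M ≤ sumClosure σ L → Stable σ M → p M → ∀ z ∉ M, σ z - z ∈ M →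
      p (adj M z)) : p (sumClosure σ L) := by
  obtain ⟨M, hLM, hM⟩ := exists_maximal_subfield
    (fun M => L ≤ M ∧ M ≤ sumClosure σ L ∧ Stable σ M ∧ p M) (fun c hne hdir hc => by
      obtain ⟨N, hN⟩ := hne
      exact ⟨(hc N hN).1.trans (le_sSup hN), sSup_le fun M hM => (hc M hM).2.1,
        stable_sSup fun M hM => (hc M hM).2.2.1, hp c ⟨N, hN⟩ hdir fun M hM => (hc M hM).2.2.2⟩)
    ⟨le_rfl, le_sumClosure L, hL, hpL⟩
  obtain ⟨⟨-, hMW, hMs, hpM⟩, hmax⟩ := hM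
  have hclosed : SumClosed σ M := by
    intro z hz
    by_contra hzM
    refine hzM (hmax ⟨hLM.trans (le_adj M z), adj_le hMW ?_, hMs.adj_sum hz,
      hstep M hLM hMW hMs hpM z hzM hz⟩ (le_adj M z) (mem_adj_self M z))
    exact sumClosed_sumClosure L z (hMW hz)
  rwa [le_antisymm (sumClosure_le hLM hMs hclosed) hMW]

/-- One sum is adjoined at a time. The element y solves β⁻¹σ(y) - y = 0, and this twist is the one
belonging to Y = y⁻¹, so `mem_of_sum_of_twisted` applies as long as y was absent before. -/
theorem not_mem_sumClosure [CharZero F] {L : Subfield F} (hL : Stable σ L)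
    (hc : ∀ c, σ c = c → c ∈ L) {y β : F} (hy : σ y = β * y) (hβ : β ∈ L) (hyL : y ∉ L) :
    y ∉ sumClosure σ L := by
  refine sumClosure_induction hL (fun M => y ∉ M) ?_ hyL ?_
  · intro c hne hdir h hy
    obtain ⟨M, hM, hyM⟩ := (Subfield.mem_sSup_of_directedOn hne hdir).1 hy
    exact h M hM hyM
  · intro M hLM _ hM hyM z hz hΔ hyz
    have hy0 : y ≠ 0 := by rintro rfl; exact hyL (zero_mem L)
    have hβ0 : β ≠ 0 := by
      rintro rfl
      rw [zero_mul, map_eq_zero_iff σ σ.injective] at hy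
      exact hy0 hy
    have hcM : ∀ c, σ c = c → c ∈ M := fun c h => hLM (hc c h)
    refine hyM (mem_of_sum_of_twisted hM hcM (transcendental_of_sub_mem hM hcM hz hΔ) hΔ
      (inv_mem (hLM hβ)) (Y := y⁻¹) ?_ ?_ hyz ?_)
    · rw [map_inv₀, hy, mul_inv]
    · rwa [inv_mem_iff]
    · rw [hy, inv_mul_cancel_left₀ hβ0, sub_self]
      exact zero_mem M

theorem ShiftClosed.mono_left {β : F} {P P' S : Subfield F} (h : ShiftClosed σ β P S)
    (hP : P' ≤ P) : ShiftClosed σ β P' S :=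
  fun w hw => h w (hP hw)

theorem ShiftClosed.sumClosure_left [CharZero F] {M S : Subfield F} (hM : Stable σ M)
    (hc : ∀ c, σ c = c → c ∈ M) (hSM : S ≤ M) {Y β : F} (hβ : β ∈ M) (hY : σ Y = β * Y)
    (hYM : Y ∉ sumClosure σ M) (h : ShiftClosed σ β M S) :
    ShiftClosed σ β (sumClosure σ M) S := by
  refine sumClosure_induction hM (fun M => ShiftClosed σ β M S) ?_ h ?_
  · intro c hne hdir h w hw
    obtain ⟨M, hM, hwM⟩ := (Subfield.mem_sSup_of_directedOn hne hdir).1 hw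
    exact h M hM w hwM
  · intro M' hMM' hM'W hM' hM'S z hz hΔ
    have hcM : ∀ c, σ c = c → c ∈ M' := fun c h => hMM' (hc c h)
    exact hM'S.adj_sum_left hM' hcM (hSM.trans hMM') (transcendental_of_sub_mem hM' hcM hz hΔ) hΔ
      (hMM' hβ) hY fun h => hYM (hM'W h)

end SumClosure

/-! ### Transcendence step by step and algebraic independence -/

section AlgebraicIndependence

theorem algebraicIndependent_of_transcendental_lt {R : Type*} {A : Type*} [Field R] [Field A]
    [Algebra R A] {n : ℕ} {t : Fin n → A}
    (h : ∀ j, Transcendental (Algebra.adjoin R (t '' {b | b < j})) (t j)) :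
    AlgebraicIndependent R t := by
  have key : ∀ l : ℕ, l ≤ n → AlgebraicIndepOn R t {b : Fin n | (b : ℕ) < l} := by
    intro l
    induction l with
    | zero =>
      intro _
      have : {b : Fin n | (b : ℕ) < 0} = ∅ := by ext; simp
      rw [this]
      exact algebraicIndependent_empty_type
    | succ l ih =>
      intro hl
      have : {b : Fin n | (b : ℕ) < l + 1} = insert ⟨l, hl⟩ {b : Fin n | (b : ℕ) < l} := by
        ext b
        simp only [Set.mem_ofPred_eq, Set.mem_insert_iff, Fin.ext_iff]
        omega
      rw [this]
      exact (AlgebraicIndepOn.insert_iff (by simp)).2 ⟨ih (by omega), h ⟨l, hl⟩⟩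
  have h1 := key n le_rfl
  have : {b : Fin n | (b : ℕ) < n} = Set.univ := by ext b; simp
  rw [this] at h1
  exact (algebraicIndependent_equiv' (Equiv.Set.univ (Fin n)) rfl).1 h1

open scoped IntermediateField.algebraAdjoinAdjoin in
theorem transcendental_sup_closure {F : Type v} [Field F] {K : Subfield F} {B : Set F} {x : F}
    (hx : Transcendental (Algebra.adjoin K B) x) :
    Transcendental (K ⊔ Subfield.closure B : Subfield F) x := by
  intro h
  have h1 : IsAlgebraic (IntermediateField.adjoin K B) x := by
    have hle : K ⊔ Subfield.closure B ≤ (IntermediateField.adjoin K B).toSubfield :=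
      sup_le (fun z hz => (IntermediateField.adjoin K B).algebraMap_mem ⟨z, hz⟩)
        (Subfield.closure_le.2 (IntermediateField.subset_adjoin K B))
    exact h.ringHom_of_comp_eq (Subfield.inclusion hle) (RingHom.id F)
      (Subfield.inclusion hle).injective rfl
  exact hx ((IsFractionRing.isAlgebraic_iff (Algebra.adjoin K B)
    (IntermediateField.adjoin K B) F).2 h1)

end AlgebraicIndependence

/-! ### Towers with levels, and the products in them -/

section DepthTower

variable {F : Type v} [Field F]

/-- The subfield generated over `K` by the `t_a` with `a ∈ A`. -/
def gen (K : Subfield F) {n : ℕ} (t : Fin n → F) (A : Set (Fin n)) : Subfield F :=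
  K ⊔ Subfield.closure (t '' A)

section Gen

variable {K : Subfield F} {n : ℕ} {t : Fin n → F} {A B : Set (Fin n)}

theorem le_gen : K ≤ gen K t A := le_sup_left

theorem mem_gen {a : Fin n} (h : a ∈ A) : t a ∈ gen K t A :=
  (le_sup_right : _ ≤ gen K t A) (Subfield.subset_closure ⟨a, h, rfl⟩)

theorem gen_le {M : Subfield F} (hK : K ≤ M) (h : ∀ a ∈ A, t a ∈ M) : gen K t A ≤ M :=
  sup_le hK (Subfield.closure_le.2 (by rintro _ ⟨a, ha, rfl⟩; exact h a ha))

theorem gen_mono (h : A ⊆ B) : gen K t A ≤ gen K t B :=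
  gen_le le_gen fun _ ha => mem_gen (h ha)

theorem gen_insert (a : Fin n) : gen K t (insert a A) = adj (gen K t A) (t a) := by
  apply le_antisymm
  · refine gen_le (le_gen.trans (le_adj _ _)) ?_
    rintro b (rfl | hb)
    · exact mem_adj_self _ _
    · exact le_adj _ _ (mem_gen hb)
  · exact adj_le (gen_mono (Set.subset_insert a A)) (mem_gen (Set.mem_insert a A))

end Gen

/-- A tower `K(t₀)…(t_{n-1})` without new constants, where every generator is a sum or a product
over the generators that precede it and that have a smaller level. -/
structure DepthTower (σ : F ≃+* F) (K : Subfield F) {n : ℕ} (t : Fin n → F) (lev : Fin n → ℕ) :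
    Prop where
  stable : Stable σ K
  const_mem : ∀ c, σ c = c → c ∈ K
  lev_pos : ∀ j, 0 < lev j
  transcendental : ∀ j, Transcendental (gen K t {b | b < j}) (t j)
  sum_or_prod : ∀ j, σ (t j) - t j ∈ gen K t {b | b < j ∧ lev b < lev j} ∨
    ∃ a ∈ gen K t {b | b < j ∧ lev b < lev j}, σ (t j) = a * t j

/-- `A` contains the generators that precede an element of `A` and have smaller level. -/
def DownClosed {n : ℕ} (lev : Fin n → ℕ) (A : Set (Fin n)) : Prop :=
  ∀ a ∈ A, ∀ b < a, lev b < lev a → b ∈ A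

namespace DepthTower

variable {σ : F ≃+* F} {K : Subfield F} {n : ℕ} {t : Fin n → F} {lev : Fin n → ℕ}
  {A B : Set (Fin n)}

theorem gen_lower_le (hA : DownClosed lev A) {a : Fin n} (ha : a ∈ A) :
    gen K t {b | b < a ∧ lev b < lev a} ≤ gen K t A :=
  gen_mono fun b hb => hA a ha b hb.1 hb.2

theorem map_mem_of_lower_le (T : DepthTower σ K t lev) {M : Subfield F} {a : Fin n}
    (h : gen K t {b | b < a ∧ lev b < lev a} ≤ M) (ha : t a ∈ M) : σ (t a) ∈ M := by
  rcases T.sum_or_prod a with h1 | ⟨α, h1, h2⟩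
  · simpa using add_mem (h h1) ha
  · rw [h2]; exact mul_mem (h h1) ha

theorem stable_gen (T : DepthTower σ K t lev) (hA : DownClosed lev A) : Stable σ (gen K t A) :=
  sup_le (fun _ hx => le_gen (T.stable hx)) (Subfield.closure_le.2 (by
    rintro _ ⟨a, ha, rfl⟩
    exact T.map_mem_of_lower_le (gen_lower_le hA ha) (mem_gen ha)))

theorem algebraicIndependent (T : DepthTower σ K t lev) {R : Type*} [Field R] [Algebra R F]
    (hR : ∀ r : R, algebraMap R F r ∈ K) : AlgebraicIndependent R t := by
  apply algebraicIndependent_of_transcendental_lt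
  intro j hj
  have hle : ∀ z ∈ Algebra.adjoin R (t '' {b | b < j}), z ∈ gen K t {b | b < j} := by
    intro z hz
    induction hz using Algebra.adjoin_induction with
    | mem x hx => obtain ⟨b, hb, rfl⟩ := hx; exact mem_gen hb
    | algebraMap r => exact le_gen (hR r)
    | add x y _ _ hx hy => exact add_mem hx hy
    | mul x y _ _ hx hy => exact mul_mem hx hy
  let f : Algebra.adjoin R (t '' {b | b < j}) →+* gen K t {b | b < j} :=
    { toFun := fun z => ⟨z, hle z z.2⟩
      map_one' := rfl
      map_mul' := fun _ _ => rfl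
      map_zero' := rfl
      map_add' := fun _ _ => rfl }
  exact T.transcendental j (hj.ringHom_of_comp_eq f (RingHom.id F)
    (fun x y h => Subtype.ext (congrArg (fun z : gen K t {b | b < j} => (z : F)) h)) rfl)

/-- Algebraic independence of the whole family frees the tower from its order: A may contain indices
above j. -/
theorem transcendental_gen (T : DepthTower σ K t lev) {j : Fin n} (hj : j ∉ A) :
    Transcendental (gen K t A) (t j) :=
  transcendental_sup_closure ((T.algebraicIndependent fun r : K => r.2).transcendental_adjoin hj)

theorem ne_zero (T : DepthTower σ K t lev) (j : Fin n) : t j ≠ 0 := fun h =>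
  T.transcendental j (h ▸ isAlgebraic_zero)

theorem zpow_not_mem (T : DepthTower σ K t lev) {j : Fin n} (hj : j ∉ A) {e : ℤ} (he : e ≠ 0) :
    t j ^ e ∉ gen K t A := by
  intro h
  have h1 : t j ^ e.natAbs ∈ gen K t A := by
    rcases Int.natAbs_eq e with h2 | h2
    · rw [h2, zpow_natCast] at h; exact h
    · rw [h2, zpow_neg, zpow_natCast, inv_mem_iff] at h; exact h
  have h3 : IsAlgebraic (gen K t A) (t j ^ e.natAbs) :=
    isAlgebraic_algebraMap (⟨_, h1⟩ : gen K t A)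
  exact T.transcendental_gen hj (h3.of_pow (by omega))

theorem zpow_mul_zpow_not_mem (T : DepthTower σ K t lev) {j l : Fin n} (hj : j ∉ A) (hjl : j ≠ l)
    {e : ℤ} (he : e ≠ 0) (e' : ℤ) : t j ^ e * t l ^ e' ∉ gen K t A := by
  intro h
  have hjl' : j ∉ insert l A := by simp [hj, hjl]
  apply T.zpow_not_mem hjl' he
  have h1 := div_mem (gen_mono (Set.subset_insert l A) h)
    (zpow_mem (mem_gen (K := K) (t := t) (Set.mem_insert l A)) e')
  rwa [mul_div_cancel_right₀ _ (zpow_ne_zero _ (T.ne_zero l))] at h1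

/-- If t_j were algebraic, some positive power of it would lie in the sum closure. That power solves
a homogeneous equation over the field generated by A, so it would already lie there. -/
theorem transcendental_sumClosure (T : DepthTower σ K t lev) [CharZero F]
    (hA : DownClosed lev A) {j : Fin n} (hj : j ∉ A)
    {α : F} (hα : α ∈ gen K t A) (hσ : σ (t j) = α * t j) :
    Transcendental (sumClosure σ (gen K t A)) (t j) := by
  by_contra h
  have hc : ∀ c, σ c = c → c ∈ gen K t A := fun c h => le_gen (T.const_mem c h)
  obtain ⟨k, hk, hmem⟩ := exists_pow_mem_of_not_transcendental (stable_sumClosure _)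
    (fun c h => le_sumClosure _ (hc c h)) h (T.ne_zero j) (le_sumClosure _ hα) hσ
  refine not_mem_sumClosure (T.stable_gen hA) hc (y := t j ^ k) (β := α ^ k) ?_
    (pow_mem hα k) ?_ hmem
  · rw [map_pow, hσ, mul_pow]
  · have := T.zpow_not_mem hj (e := k) (by omega)
    rwa [zpow_natCast] at this

/-- For a twist β coming from Y = t_j^e with j outside B, shift-closedness needs no hypothesis on
the fields beyond their position, since Y times a power of another product stays outside all of
them. The generators in B but not in A are adjoined by increasing index: sums are absorbed by the
sum closure, products are handled by `ShiftClosed.adj_prod_left`, and then the sum closure is taken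
again. -/
theorem shiftClosed_sumClosure (T : DepthTower σ K t lev) [CharZero F] (hAB : A ⊆ B)
    (hA : DownClosed lev A)
    (hB : DownClosed lev B) {j : Fin n} (hj : j ∉ B) {e : ℤ} (he : e ≠ 0) {β : F}
    (hβ : β ∈ gen K t A) (hY : σ (t j ^ e) = β * t j ^ e) {S : Subfield F}
    (hS : gen K t A ≤ S) (hSA : S ≤ sumClosure σ (gen K t A)) (hSσ : Stable σ S) :
    ShiftClosed σ β (sumClosure σ (gen K t B)) S := by
  have hcA : ∀ C, ∀ c, σ c = c → c ∈ gen K t C := fun C c h => le_gen (T.const_mem c h)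
  have key : ∀ l : ℕ, ShiftClosed σ β
      (sumClosure σ (gen K t (A ∪ {a | a ∈ B ∧ (a : ℕ) < l}))) S := by
    intro l
    induction l with
    | zero =>
      have h0 : A ∪ {a | a ∈ B ∧ (a : ℕ) < 0} = A := by ext; simp
      rw [h0]
      have hcS : ∀ c, σ c = c → c ∈ S := fun c h => hS (hcA A c h)
      have h1 : ShiftClosed σ β S S := by
        intro w hw _; exact hw
      -- The start is the trivial statement for S over itself, carried to the sum closure of S.
      refine (h1.sumClosure_left hSσ hcS le_rfl (hS hβ) hY fun h => ?_).mono_left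
        (sumClosure_mono hS)
      exact not_mem_sumClosure (T.stable_gen hA) (hcA A) hY hβ
        (T.zpow_not_mem (fun h => hj (hAB h)) he) (sumClosure_le_sumClosure hSA h)
    | succ l ih =>
      set C := A ∪ {a | a ∈ B ∧ (a : ℕ) < l} with hC
      set C' := A ∪ {a | a ∈ B ∧ (a : ℕ) < l + 1} with hC'
      by_cases hl : ∃ a ∈ B, (a : ℕ) = l ∧ a ∉ A
      · obtain ⟨a, haB, hal, haA⟩ := hl
        have hCC' : C' = insert a C := by
          ext b
          simp only [hC, hC', Set.mem_union, Set.mem_ofPred_eq, Set.mem_insert_iff, Fin.ext_iff]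
          constructor
          · rintro (h | ⟨h, h'⟩)
            · exact Or.inr (Or.inl h)
            · by_cases hb : (b : ℕ) = a
              · exact Or.inl hb
              · exact Or.inr (Or.inr ⟨h, by omega⟩)
          · rintro (h | h | ⟨h, h'⟩)
            · obtain rfl : b = a := Fin.ext h
              exact Or.inr ⟨haB, by omega⟩
            · exact Or.inl h
            · exact Or.inr ⟨h, by omega⟩
        have hCd : DownClosed lev C := by
          rintro c (hc | ⟨hc, hc'⟩) b hb hlev
          · exact Or.inl (hA c hc b hb hlev)
          · exact Or.inr ⟨hB c hc b hb hlev, lt_trans hb hc'⟩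
        have hCd' : DownClosed lev C' := by
          rintro c (hc | ⟨hc, hc'⟩) b hb hlev
          · exact Or.inl (hA c hc b hb hlev)
          · exact Or.inr ⟨hB c hc b hb hlev, lt_trans hb hc'⟩
        have haC : a ∉ C := by
          rintro (h | ⟨-, h⟩)
          · exact haA h
          · omega
        have hAC : A ⊆ C := Set.subset_union_left
        have hC'B : C' ⊆ B := Set.union_subset hAB fun _ h => h.1
        have hlow : gen K t {b | b < a ∧ lev b < lev a} ≤ gen K t C :=
          gen_mono fun b hb => Or.inr ⟨hB a haB b hb.1 hb.2, by have := hb.1; omega⟩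
        set M := sumClosure σ (gen K t C) with hM
        have hgM : gen K t C ≤ M := le_sumClosure _
        rcases T.sum_or_prod a with h | ⟨α, h, hα⟩
        · have haM : t a ∈ M := sumClosed_sumClosure _ _ (hgM (hlow h))
          refine ih.mono_left (sumClosure_le_sumClosure ?_)
          rw [hCC', gen_insert]
          exact adj_le hgM haM
        · have htr := T.transcendental_sumClosure hCd haC (hlow h) hα
          have hcM : ∀ c, σ c = c → c ∈ M := fun c h => hgM (hcA C c h)
          have hMσ : Stable σ M := stable_sumClosure _
          have hSM : S ≤ M := hSA.trans (sumClosure_mono (gen_mono hAC))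
          have hβC : β ∈ gen K t C := gen_mono hAC hβ
          have hjC : j ∉ C' := fun h => hj (hC'B h)
          have hja : j ≠ a := by rintro rfl; exact hj haB
          have h1 : ShiftClosed σ β (adj M (t a)) S := by
            refine ih.adj_prod_left hMσ hcM hSM htr (hgM (hlow h)) hα (hgM hβC) hY
              fun e' _ => ?_
            refine not_mem_sumClosure (T.stable_gen hCd) (hcA C) (β := β * α ^ e') ?_
              (mul_mem hβC (zpow_mem (hlow h) e')) (T.zpow_mul_zpow_not_mem
                (fun h => hjC (hCC' ▸ Set.mem_insert_of_mem a h)) hja he e')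
            rw [map_mul, hY, map_zpow₀, hα, mul_zpow]
            ring
          have h2 : adj M (t a) ≤ sumClosure σ (gen K t C') := by
            rw [hCC', gen_insert]
            exact adj_le (sumClosure_mono (le_adj _ _)) (le_sumClosure _ (mem_adj_self _ _))
          have h3 : gen K t C' ≤ adj M (t a) := by
            rw [hCC', gen_insert]
            exact adj_mono hgM _
          refine (h1.sumClosure_left (hMσ.adj ?_) (fun c h => le_adj M _ (hcM c h))
            (hSM.trans (le_adj M _)) (le_adj M _ (hgM hβC)) hY fun h => ?_).mono_left
            (sumClosure_mono h3)
          · rw [hα]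
            exact mul_mem (le_adj M _ (hgM (hlow h))) (mem_adj_self M _)
          · exact not_mem_sumClosure (T.stable_gen hCd') (hcA C') hY
              (h3.trans h2 |> fun _ => gen_mono (hCC' ▸ Set.subset_insert a C) hβC)
              (T.zpow_not_mem hjC he) (sumClosure_le_sumClosure h2 h)
      · have hCC' : C' = C := by
          ext b
          simp only [hC, hC', Set.mem_union, Set.mem_ofPred_eq]
          constructor
          · rintro (h | ⟨h, h'⟩)
            · exact Or.inl h
            · by_cases hb : (b : ℕ) = l
              · by_contra hn
                exact hl ⟨b, h, hb, fun h => hn (Or.inl h)⟩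
              · exact Or.inr ⟨h, by omega⟩
          · rintro (h | ⟨h, h'⟩)
            · exact Or.inl h
            · exact Or.inr ⟨h, by omega⟩
        rw [hCC']
        exact ih
  refine (key n).mono_left (sumClosure_mono (gen_mono ?_))
  exact fun b hb => Or.inr ⟨hb, b.2⟩

end DepthTower

end DepthTower

end DiffField

namespace DiffField

/-! ### Nested sums, and shift-closedness between two stages -/

section NestedSums

variable {F : Type v} [Field F]

/-- The elements with `k`-fold nested sums over `K` and over the generators `t_j` with `j < i`:
in the step from `k` to `k + 1`, all sums in `F` and the generators of level `k + 1` are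
adjoined. -/
def nest (σ : F ≃+* F) (K : Subfield F) {n : ℕ} (t : Fin n → F) (lev : Fin n → ℕ) (i : ℕ) :
    ℕ → Subfield F
  | 0 => K
  | k + 1 => Subfield.closure
      ({z | σ z - z ∈ nest σ K t lev i k} ∪ t '' {j | (j : ℕ) < i ∧ lev j = k + 1})

variable {σ : F ≃+* F}

theorem Stable.sub_mem {L : Subfield F} (hL : Stable σ L) {z : F} (hz : z ∈ L) : σ z - z ∈ L :=
  _root_.sub_mem (show σ z ∈ L from hL hz) hz

theorem shiftClosed_one_iff {P S : Subfield F} :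
    ShiftClosed σ 1 P S ↔ ∀ w ∈ P, σ w - w ∈ S → w ∈ S := by
  simp only [ShiftClosed, one_mul]

theorem ShiftClosed.adj_sum [CharZero F] {Q R : Subfield F} (hQ : Stable σ Q) (hR : Stable σ R)
    (hc : ∀ c, σ c = c → c ∈ Q) (hRQ : R ≤ Q) {x : F} (hx : σ x - x ∈ R)
    (h : ShiftClosed σ 1 Q R) : ShiftClosed σ 1 (adj Q x) (adj R x) := by
  by_cases hxQ : x ∈ Q
  · have hxR : x ∈ R := shiftClosed_one_iff.1 h x hxQ hx
    rwa [adj_eq_self hxQ, adj_eq_self hxR]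
  · refine ShiftClosed.adj_adj hQ hR hc hRQ (transcendental_of_sub_mem hQ hc hxQ (hRQ hx))
      (one_mem R) hx one_ne_zero (by ring) (Or.inl rfl) fun e => ?_
    rwa [one_zpow]

theorem stable_gen_of_map_mem {M : Subfield F} (hM : Stable σ M) {n : ℕ} {t : Fin n → F}
    {A : Set (Fin n)} (h : ∀ a ∈ A, σ (t a) ∈ gen M t A) : Stable σ (gen M t A) :=
  sup_le (fun _ hx => le_gen (hM hx)) (Subfield.closure_le.2 (by
    rintro _ ⟨a, ha, rfl⟩; exact h a ha))

theorem gen_empty {M : Subfield F} {n : ℕ} {t : Fin n → F} : gen M t ∅ = M := by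
  simp [gen]

theorem gen_mono_base {M N : Subfield F} (h : M ≤ N) {n : ℕ} {t : Fin n → F} (A : Set (Fin n)) :
    gen M t A ≤ gen N t A :=
  sup_le_sup_right h _

theorem exists_mem_sup_of_mem_sup_sSup {Q : Subfield F} {c : Set (Subfield F)} (hne : c.Nonempty)
    (hdir : DirectedOn (· ≤ ·) c) {w : F} (hw : w ∈ Q ⊔ sSup c) : ∃ M ∈ c, w ∈ Q ⊔ M := by
  have h1 : Q ⊔ sSup c ≤ sSup ((Q ⊔ ·) '' c) := by
    refine sup_le ?_ (sSup_le fun M hM => ?_)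
    · obtain ⟨M, hM⟩ := hne
      exact le_sup_left.trans (le_sSup (Set.mem_image_of_mem (Q ⊔ ·) hM))
    · exact le_sup_right.trans (le_sSup (Set.mem_image_of_mem (Q ⊔ ·) hM))
  have h2 : DirectedOn (· ≤ ·) ((Q ⊔ ·) '' c) := by
    rintro _ ⟨M, hM, rfl⟩ _ ⟨N, hN, rfl⟩
    obtain ⟨O, hO, hMO, hNO⟩ := hdir M hM N hN
    exact ⟨_, ⟨O, hO, rfl⟩, sup_le_sup_left hMO Q, sup_le_sup_left hNO Q⟩
  obtain ⟨_, ⟨M, hM, rfl⟩, hwM⟩ := (Subfield.mem_sSup_of_directedOn (hne.image _) h2).1 (h1 hw)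
  exact ⟨M, hM, hwM⟩

namespace DepthTower

variable {K : Subfield F} {n : ℕ} {t : Fin n → F} {lev : Fin n → ℕ}

theorem gen_lower_le_gen {i k : ℕ} {j : Fin n} (hj : (j : ℕ) ≤ i) (hk : lev j ≤ k + 1) :
    gen K t {b | b < j ∧ lev b < lev j} ≤ gen K t {b | (b : ℕ) < i ∧ lev b ≤ k} :=
  gen_mono fun b hb => by
    have := hb.1; have := hb.2
    exact ⟨by omega, by omega⟩

theorem nest_basic (T : DepthTower σ K t lev) (i k : ℕ) : Stable σ (nest σ K t lev i k) ∧
    gen K t {b | (b : ℕ) < i ∧ lev b ≤ k} ≤ nest σ K t lev i k ∧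
    nest σ K t lev i k ≤ nest σ K t lev i (k + 1) := by
  have hstep : ∀ k, Stable σ (nest σ K t lev i k) →
      nest σ K t lev i k ≤ nest σ K t lev i (k + 1) := fun k hs z hz =>
    Subfield.subset_closure (Or.inl (hs.sub_mem hz))
  induction k with
  | zero =>
    refine ⟨T.stable, gen_le le_rfl ?_, hstep 0 T.stable⟩
    rintro a ⟨-, ha⟩
    have := T.lev_pos a
    omega
  | succ k ih =>
    obtain ⟨hs, hg, hle⟩ := ih
    have hs' : Stable σ (nest σ K t lev i (k + 1)) := by
      apply stable_closure
      rintro x (hx | ⟨j, ⟨hj, hjk⟩, rfl⟩)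
      · have := add_mem (hle hx) (Subfield.subset_closure (Or.inl hx) :
          x ∈ nest σ K t lev i (k + 1))
        rwa [sub_add_cancel] at this
      · exact T.map_mem_of_lower_le (((gen_lower_le_gen hj.le hjk.le).trans hg).trans hle)
          (Subfield.subset_closure (Or.inr ⟨j, ⟨hj, hjk⟩, rfl⟩))
    refine ⟨hs', gen_le (le_gen.trans (hg.trans hle)) ?_, hstep _ hs'⟩
    rintro a ⟨ha, hk⟩
    by_cases h : lev a ≤ k
    · exact hle (hg (mem_gen ⟨ha, h⟩))
    · exact Subfield.subset_closure (Or.inr ⟨a, ⟨ha, by omega⟩, rfl⟩)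

theorem stable_nest (T : DepthTower σ K t lev) (i k : ℕ) : Stable σ (nest σ K t lev i k) :=
  (T.nest_basic i k).1

theorem gen_le_nest (T : DepthTower σ K t lev) (i k : ℕ) :
    gen K t {b | (b : ℕ) < i ∧ lev b ≤ k} ≤ nest σ K t lev i k :=
  (T.nest_basic i k).2.1

theorem nest_le_succ (T : DepthTower σ K t lev) (i k : ℕ) :
    nest σ K t lev i k ≤ nest σ K t lev i (k + 1) :=
  (T.nest_basic i k).2.2

theorem nest_mono_right (T : DepthTower σ K t lev) (i : ℕ) : Monotone (nest σ K t lev i) :=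
  monotone_nat_of_le_succ (T.nest_le_succ i)

theorem base_le_nest (T : DepthTower σ K t lev) (i k : ℕ) : K ≤ nest σ K t lev i k :=
  le_gen.trans (T.gen_le_nest i k)

theorem gen_mem_nest (T : DepthTower σ K t lev) {i k : ℕ} {j : Fin n} (hj : (j : ℕ) < i)
    (hk : lev j ≤ k) : t j ∈ nest σ K t lev i k :=
  T.gen_le_nest i k (mem_gen ⟨hj, hk⟩)

theorem gen_lower_le_nest (T : DepthTower σ K t lev) {i k : ℕ} {j : Fin n} (hj : (j : ℕ) ≤ i)
    (hk : lev j ≤ k + 1) : gen K t {b | b < j ∧ lev b < lev j} ≤ nest σ K t lev i k :=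
  (gen_lower_le_gen hj hk).trans (T.gen_le_nest i k)

theorem sum_mem_nest {i k : ℕ} {z : F} (hz : σ z - z ∈ nest σ K t lev i k) :
    z ∈ nest σ K t lev i (k + 1) :=
  Subfield.subset_closure (Or.inl hz)

theorem nest_mono_left {i i' : ℕ} (h : i ≤ i') (k : ℕ) :
    nest σ K t lev i k ≤ nest σ K t lev i' k := by
  induction k with
  | zero => exact le_rfl
  | succ k ih =>
    refine Subfield.closure_mono (Set.union_subset_union (fun z hz => ih hz) ?_)
    exact Set.image_mono fun j hj => ⟨hj.1.trans_le h, hj.2⟩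

theorem nest_le_sumClosure (i k : ℕ) :
    nest σ K t lev i k ≤ sumClosure σ (gen K t {b | (b : ℕ) < i ∧ lev b ≤ k}) := by
  induction k with
  | zero => exact le_gen.trans (le_sumClosure _)
  | succ k ih =>
    have hm : sumClosure σ (gen K t {b : Fin n | (b : ℕ) < i ∧ lev b ≤ k}) ≤
        sumClosure σ (gen K t {b | (b : ℕ) < i ∧ lev b ≤ k + 1}) :=
      sumClosure_mono (gen_mono fun b hb => ⟨hb.1, hb.2.trans (Nat.le_succ k)⟩)
    refine Subfield.closure_le.2 ?_
    rintro x (hx | ⟨j, ⟨hj, hjk⟩, rfl⟩)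
    · exact sumClosed_sumClosure _ x (hm (ih hx))
    · exact le_sumClosure _ (mem_gen ⟨hj, hjk.le⟩)

/-- Among the twists α^e required by `ShiftClosed.adj_adj`, e = 0 is the hypothesis, and e ≠ 0 is
covered by `shiftClosed_sumClosure` with Y = t_a^e. -/
theorem shiftClosed_adj_prod [CharZero F] (T : DepthTower σ K t lev) {A B : Set (Fin n)}
    (hAB : A ⊆ B) (hA : DownClosed lev A) (hB : DownClosed lev B) {a : Fin n} (ha : a ∉ B)
    {α : F} (hα : α ∈ gen K t A) (hσ : σ (t a) = α * t a) {Q R : Subfield F}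
    (hQ : Stable σ Q) (hR : Stable σ R) (hRQ : R ≤ Q) (hAR : gen K t A ≤ R)
    (hRA : R ≤ sumClosure σ (gen K t A)) (hQB : Q ≤ sumClosure σ (gen K t B))
    (h : ShiftClosed σ 1 Q R) : ShiftClosed σ 1 (adj Q (t a)) (adj R (t a)) := by
  have hα0 : α ≠ 0 := by
    rintro rfl
    rw [zero_mul, map_eq_zero_iff σ σ.injective] at hσ
    exact T.ne_zero a hσ
  refine ShiftClosed.adj_adj hQ hR (fun c h => hRQ (hAR (le_gen (T.const_mem c h)))) hRQ
    (transcendental_mono hQB (T.transcendental_sumClosure hB ha (gen_mono hAB hα) hσ))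
    (hAR hα) (zero_mem R) hα0 (by rw [hσ, add_zero]) (Or.inr rfl) fun e => ?_
  by_cases he : e = 0
  · rwa [he, zpow_zero]
  · refine (T.shiftClosed_sumClosure hAB hA hB ha he (zpow_mem hα e) ?_ hAR hRA hR).mono_left hQB
    rw [map_zpow₀, hσ, mul_zpow]

/-- Products of level k + 1 are adjoined by increasing index. Those of index below i go to both
fields, the others to the larger one only. -/
theorem shiftClosed_gen_prod [CharZero F] (T : DepthTower σ K t lev) {i k : ℕ} (hi : i ≤ n)
    {P : Subfield F} (hnP : nest σ K t lev n k ≤ P)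
    (hPW : P ≤ sumClosure σ (gen K t {b | lev b ≤ k})) (hP : Stable σ P)
    (h : ShiftClosed σ 1 P (nest σ K t lev i k)) (l : ℕ) :
    ShiftClosed σ 1
      (gen P t {b | (b : ℕ) < l ∧ lev b = k + 1 ∧
        ∃ a ∈ gen K t {c | c < b ∧ lev c < lev b}, σ (t b) = a * t b})
      (gen (nest σ K t lev i k) t {b | (b : ℕ) < l ∧ (b : ℕ) < i ∧ lev b = k + 1 ∧
        ∃ a ∈ gen K t {c | c < b ∧ lev c < lev b}, σ (t b) = a * t b}) := by
  set S := nest σ K t lev i k with hS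
  let pr : Fin n → Prop := fun b => ∃ a ∈ gen K t {c | c < b ∧ lev c < lev b}, σ (t b) = a * t b
  let Y : ℕ → Set (Fin n) := fun l => {b | (b : ℕ) < l ∧ lev b = k + 1 ∧ pr b}
  let X : ℕ → Set (Fin n) := fun l => {b | (b : ℕ) < l ∧ (b : ℕ) < i ∧ lev b = k + 1 ∧ pr b}
  change ShiftClosed σ 1 (gen P t (Y l)) (gen S t (X l))
  have hXY : ∀ l, X l ⊆ Y l := fun l b hb => ⟨hb.1, hb.2.2⟩
  have hSP : S ≤ P := (nest_mono_left hi k).trans hnP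
  have hPn : ∀ b : Fin n, lev b ≤ k + 1 → gen K t {c | c < b ∧ lev c < lev b} ≤ P := fun b hb =>
    (T.gen_lower_le_nest b.2.le hb).trans hnP
  have hYs : ∀ l, Stable σ (gen P t (Y l)) := fun l =>
    stable_gen_of_map_mem hP fun b hb =>
      T.map_mem_of_lower_le ((hPn b hb.2.1.le).trans le_gen) (mem_gen hb)
  have hXs : ∀ l, Stable σ (gen S t (X l)) := fun l =>
    stable_gen_of_map_mem (T.stable_nest i k) fun b hb =>
      T.map_mem_of_lower_le ((T.gen_lower_le_nest hb.2.1.le hb.2.2.1.le).trans le_gen) (mem_gen hb)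
  induction l with
  | zero =>
    have hX0 : X 0 = ∅ := by ext; simp [X]
    have hY0 : Y 0 = ∅ := by ext; simp [Y]
    rwa [hX0, hY0, gen_empty, gen_empty]
  | succ l ih =>
    by_cases hl : ∃ a : Fin n, (a : ℕ) = l ∧ lev a = k + 1 ∧ pr a
    · obtain ⟨a, hal, hak, hpa⟩ := hl
      obtain ⟨α, hα, hσ⟩ := hpa
      have hY' : Y (l + 1) = insert a (Y l) := by
        ext b
        constructor
        · rintro ⟨h1, h2⟩
          by_cases hb : b = a
          · exact Or.inl hb
          · have : (b : ℕ) ≠ a := fun h => hb (Fin.ext h)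
            exact Or.inr ⟨by omega, h2⟩
        · rintro (rfl | ⟨h1, h2⟩)
          · exact ⟨by omega, hak, α, hα, hσ⟩
          · exact ⟨by omega, h2⟩
      let B : Set (Fin n) := {b | lev b ≤ k} ∪ Y l
      have hB : DownClosed lev B := by
        rintro c (hc | hc) b hb hlev
        · exact Or.inl (hlev.le.trans hc)
        · have := hc.2.1
          exact Or.inl (by change lev b ≤ k; omega)
      have haB : a ∉ B := by
        rintro (h | h)
        · have : lev a ≤ k := h
          omega
        · have := h.1
          omega
      have hQB : gen P t (Y l) ≤ sumClosure σ (gen K t B) :=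
        gen_le (hPW.trans (sumClosure_mono (gen_mono fun b hb => Or.inl hb)))
          fun b hb => le_sumClosure _ (mem_gen (Or.inr hb))
      by_cases hai : (a : ℕ) < i
      · have hX' : X (l + 1) = insert a (X l) := by
          ext b
          constructor
          · rintro ⟨h1, h2⟩
            by_cases hb : b = a
            · exact Or.inl hb
            · have : (b : ℕ) ≠ a := fun h => hb (Fin.ext h)
              exact Or.inr ⟨by omega, h2⟩
          · rintro (rfl | ⟨h1, h2⟩)
            · exact ⟨by omega, hai, hak, α, hα, hσ⟩
            · exact ⟨by omega, h2⟩
        rw [hX', hY', gen_insert, gen_insert]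
        let A : Set (Fin n) := {b | (b : ℕ) < i ∧ lev b ≤ k} ∪ X l
        have hA : DownClosed lev A := by
          rintro c (hc | hc) b hb hlev
          · exact Or.inl ⟨lt_trans hb hc.1, hlev.le.trans hc.2⟩
          · have := hc.2.2.1
            exact Or.inl ⟨lt_trans hb hc.2.1, by omega⟩
        have hAB : A ⊆ B := Set.union_subset_union (fun b hb => hb.2) (hXY l)
        have hαA : α ∈ gen K t A := gen_mono (fun b hb => Or.inl hb)
          (gen_lower_le_gen hai.le hak.le hα)
        refine T.shiftClosed_adj_prod hAB hA hB haB hαA hσ (hYs l) (hXs l)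
          (gen_le (hSP.trans le_gen) fun b hb => mem_gen (hXY l hb)) ?_ ?_ hQB ih
        · refine gen_le ((T.base_le_nest i k).trans le_gen) ?_
          rintro b (hb | hb)
          · exact le_gen (T.gen_le_nest i k (mem_gen hb))
          · exact mem_gen hb
        · refine gen_le ((nest_le_sumClosure i k).trans
            (sumClosure_mono (gen_mono fun b hb => Or.inl hb))) fun b hb => ?_
          exact le_sumClosure _ (mem_gen (Or.inr hb))
      · have hX' : X (l + 1) = X l := by
          ext b
          constructor
          · rintro ⟨h1, h2⟩
            exact ⟨by omega, h2⟩
          · rintro ⟨h1, h2⟩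
            exact ⟨by omega, h2⟩
        rw [hX', hY', gen_insert]
        have hαB : α ∈ gen K t B := gen_mono (fun b hb => Or.inl hb.2)
          (gen_lower_le_gen (i := n) a.2.le hak.le hα)
        have hαP : α ∈ gen P t (Y l) := le_gen (hPn a hak.le hα)
        have hcK : ∀ c, σ c = c → c ∈ gen K t B := fun c h => le_gen (T.const_mem c h)
        -- With β = 1 and Y = 1 the condition on Y only says that no nonzero power of t_a lies in
        -- the field.
        refine ih.adj_prod_left (hYs l)
          (fun c h => le_gen (hnP (T.base_le_nest n k (T.const_mem c h))))
          (gen_le (hSP.trans le_gen) fun b hb => mem_gen (hXY l hb))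
          (transcendental_mono hQB (T.transcendental_sumClosure hB haB hαB hσ)) hαP hσ
          (one_mem _) (Y := 1) (by simp) fun e he hmem => ?_
        rw [one_mul] at hmem
        refine not_mem_sumClosure (T.stable_gen hB) hcK (β := α ^ e) ?_ (zpow_mem hαB e)
          (T.zpow_not_mem haB he) (hQB hmem)
        rw [map_zpow₀, hσ, mul_zpow]
    · have hY' : Y (l + 1) = Y l := by
        ext b
        constructor
        · rintro ⟨h1, h2⟩
          refine ⟨?_, h2⟩
          by_contra h3
          exact hl ⟨b, by omega, h2⟩
        · rintro ⟨h1, h2⟩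
          exact ⟨by omega, h2⟩
      have hX' : X (l + 1) = X l := by
        ext b
        constructor
        · rintro ⟨h1, h2⟩
          refine ⟨?_, h2⟩
          by_contra h3
          exact hl ⟨b, by omega, h2.2⟩
        · rintro ⟨h1, h2⟩
          exact ⟨by omega, h2⟩
      rw [hX', hY']
      exact ih

/-- P' plays the role of a complement to the sums over S. If a sum z over P cannot be added to a
maximal P', then P'(z) contains a forbidden sum w over S. By `eq_linear_of_sum`, w = cz + l with c,
l in P', and c ≠ 0 because P' itself is shift-closed. So z is expressed by w and P'. -/
theorem exists_maximal_sum_extension [CharZero F] {P S : Subfield F} (hP : Stable σ P)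
    (hc : ∀ c, σ c = c → c ∈ P) (hSP : S ≤ P) (h : ShiftClosed σ 1 P S) :
    ∃ P', P ≤ P' ∧ P' ≤ Subfield.closure {z | σ z - z ∈ P} ∧ Stable σ P' ∧ ShiftClosed σ 1 P' S ∧
      ∀ z, σ z - z ∈ P → z ∈ P' ⊔ Subfield.closure {z | σ z - z ∈ S} := by
  obtain ⟨P', hPP', hmax⟩ := exists_maximal_subfield
    (fun M => P ≤ M ∧ M ≤ Subfield.closure {z | σ z - z ∈ P} ∧ Stable σ M ∧ ShiftClosed σ 1 M S)
    (fun c hne hdir h => by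
      obtain ⟨N, hN⟩ := hne
      refine ⟨(h N hN).1.trans (le_sSup hN), sSup_le fun M hM => (h M hM).2.1,
        stable_sSup fun M hM => (h M hM).2.2.1, fun w hw => ?_⟩
      obtain ⟨M, hM, hwM⟩ := (Subfield.mem_sSup_of_directedOn ⟨N, hN⟩ hdir).1 hw
      exact (h M hM).2.2.2 w hwM)
    (L := P) ⟨le_rfl, fun z hz => Subfield.subset_closure (hP.sub_mem hz), hP, h⟩
  obtain ⟨⟨-, hP'1, hP'2, hP'3⟩, hP'max⟩ := hmax
  refine ⟨P', hPP', hP'1, hP'2, hP'3, fun z hz => ?_⟩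
  have hl : P' ≤ P' ⊔ Subfield.closure {z | σ z - z ∈ S} := le_sup_left
  by_cases hzP' : z ∈ P'
  · exact hl hzP'
  · have hcP' : ∀ c, σ c = c → c ∈ P' := fun c h => hPP' (hc c h)
    have htr := transcendental_of_sub_mem hP'2 hcP' hzP' (hPP' hz)
    have hnot : ¬ ShiftClosed σ 1 (adj P' z) S := fun hcl =>
      hzP' (hP'max ⟨hPP'.trans (le_adj _ _), adj_le hP'1 (Subfield.subset_closure hz),
        hP'2.adj_sum (hPP' hz), hcl⟩ (le_adj P' z) (mem_adj_self P' z))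
    rw [shiftClosed_one_iff] at hnot
    push Not at hnot
    obtain ⟨w, hw, hΔ, hwS⟩ := hnot
    obtain ⟨c, hcm, l, hlm, -, hwl⟩ :=
      eq_linear_of_sum hP'2 hcP' htr (hPP' hz) hw (hPP' (hSP hΔ))
    have hc0 : c ≠ 0 := by
      rintro rfl
      rw [zero_mul, zero_add] at hwl
      exact hwS (shiftClosed_one_iff.1 hP'3 w (hwl ▸ hlm) hΔ)
    have hz' : z = (w - l) / c := by
      rw [hwl]; field_simp; ring
    rw [hz']
    exact div_mem (sub_mem ((le_sup_right : _ ≤ P' ⊔ _) (Subfield.subset_closure hΔ)) (hl hlm))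
      (hl hcm)

/-- A sum over S can be adjoined to both fields at once by `ShiftClosed.adj_sum`; Zorn collects all
of them. -/
theorem exists_shiftClosed_of_sums [CharZero F] {Q R S N : Subfield F} (hQ : Stable σ Q)
    (hR : Stable σ R) (hc : ∀ c, σ c = c → c ∈ R) (hRQ : R ≤ Q) (hSR : S ≤ R) (hRN : R ≤ N)
    (hN : ∀ z, σ z - z ∈ S → z ∈ N) (h : ShiftClosed σ 1 Q R) :
    ∃ M, R ≤ M ∧ M ≤ N ∧ (∀ z, σ z - z ∈ S → z ∈ M) ∧ ShiftClosed σ 1 (Q ⊔ M) M := by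
  obtain ⟨M, hRM, hmax⟩ := exists_maximal_subfield
    (fun M => R ≤ M ∧ M ≤ N ∧ Stable σ M ∧ ShiftClosed σ 1 (Q ⊔ M) M)
    (fun c hne hdir h => by
      obtain ⟨N, hN⟩ := hne
      refine ⟨(h N hN).1.trans (le_sSup hN), sSup_le fun M hM => (h M hM).2.1,
        stable_sSup fun M hM => (h M hM).2.2.1, fun w hw hΔ => ?_⟩
      obtain ⟨M, hM, hwM⟩ := exists_mem_sup_of_mem_sup_sSup ⟨N, hN⟩ hdir hw
      obtain ⟨M', hM', hΔ'⟩ := (Subfield.mem_sSup_of_directedOn ⟨N, hN⟩ hdir).1 hΔ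
      obtain ⟨O, hO, hMO, hMO'⟩ := hdir M hM M' hM'
      exact le_sSup hO ((h O hO).2.2.2 w (sup_le_sup_left hMO Q hwM) (hMO' hΔ')))
    (L := R) ⟨le_rfl, hRN, hR, by rwa [sup_eq_left.2 hRQ]⟩
  obtain ⟨⟨-, hMN, hM, hMcl⟩, hMmax⟩ := hmax
  refine ⟨M, hRM, hMN, fun z hz => ?_, hMcl⟩
  have hzM : σ z - z ∈ M := hRM (hSR hz)
  refine hMmax ⟨hRM.trans (le_adj _ _), adj_le hMN (hN z hz), hM.adj_sum hzM, ?_⟩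
    (le_adj M z) (mem_adj_self M z)
  have h1 : Q ⊔ adj M z = adj (Q ⊔ M) z := (sup_assoc _ _ _).symm
  rw [h1]
  exact hMcl.adj_sum (hQ.sup hM) hM (fun c h => (le_sup_right : M ≤ Q ⊔ M) (hRM (hc c h)))
    le_sup_right hzM

/-- The new elements of the larger field are sorted into three kinds, adjoined in this order: sums
complementary to those over the smaller field, which enlarge only the left side; the products of
level k + 1; and the sums over the smaller field, which go to both sides. Generators of level k + 1
that are sums over level k need no separate treatment. -/
theorem shiftClosed_nest [CharZero F] (T : DepthTower σ K t lev) {i : ℕ} (hi : i ≤ n) (k : ℕ) :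
    ShiftClosed σ 1 (nest σ K t lev n k) (nest σ K t lev i k) := by
  induction k with
  | zero => exact fun w hw _ => hw
  | succ k ih =>
    have hSP : nest σ K t lev i k ≤ nest σ K t lev n k := nest_mono_left hi k
    have hcS : ∀ c, σ c = c → c ∈ nest σ K t lev i k := fun c h =>
      T.base_le_nest i k (T.const_mem c h)
    obtain ⟨P', hPP', hP'N, hP's, hP'cl, hP'sum⟩ := exists_maximal_sum_extension
      (T.stable_nest n k) (fun c h => hSP (hcS c h)) hSP ih
    have hPW : P' ≤ sumClosure σ (gen K t {b | lev b ≤ k}) := by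
      refine hP'N.trans (Subfield.closure_le.2 fun z hz => ?_)
      have h1 : σ z - z ∈ sumClosure σ (gen K t {b | lev b ≤ k}) :=
        sumClosure_mono (gen_mono fun b hb => hb.2) (nest_le_sumClosure n k hz)
      exact sumClosed_sumClosure _ z h1
    have hQR := T.shiftClosed_gen_prod hi hPP' hPW hP's hP'cl n
    set Y := {b : Fin n | (b : ℕ) < n ∧ lev b = k + 1 ∧
        ∃ a ∈ gen K t {c | c < b ∧ lev c < lev b}, σ (t b) = a * t b} with hY
    set X := {b : Fin n | (b : ℕ) < n ∧ (b : ℕ) < i ∧ lev b = k + 1 ∧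
        ∃ a ∈ gen K t {c | c < b ∧ lev c < lev b}, σ (t b) = a * t b} with hX
    have hYs : Stable σ (gen P' t Y) := stable_gen_of_map_mem hP's fun b hb =>
      T.map_mem_of_lower_le (((T.gen_lower_le_nest b.2.le hb.2.1.le).trans hPP').trans le_gen)
        (mem_gen hb)
    have hXs : Stable σ (gen (nest σ K t lev i k) t X) :=
      stable_gen_of_map_mem (T.stable_nest i k) fun b hb =>
        T.map_mem_of_lower_le ((T.gen_lower_le_nest hb.2.1.le hb.2.2.1.le).trans le_gen)
          (mem_gen hb)
    obtain ⟨M, hRM, hMN, hMsum, hMcl⟩ := exists_shiftClosed_of_sums hYs hXs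
      (fun c h => le_gen (hcS c h))
      (gen_le ((hSP.trans hPP').trans le_gen) fun b hb => mem_gen ⟨hb.1, hb.2.2⟩) le_gen
      (N := nest σ K t lev i (k + 1))
      (gen_le (T.nest_le_succ i k) fun b hb => T.gen_mem_nest hb.2.1 hb.2.2.1.le)
      (fun z hz => sum_mem_nest hz) hQR
    have hM : nest σ K t lev i (k + 1) = M := by
      refine le_antisymm (Subfield.closure_le.2 ?_) hMN
      rintro x (hx | ⟨j, ⟨hj, hjk⟩, rfl⟩)
      · exact hMsum x hx
      · rcases T.sum_or_prod j with h | h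
        · exact hMsum _ (T.gen_lower_le_nest hj.le hjk.le h)
        · exact hRM (mem_gen ⟨j.2, hj, hjk, h⟩)
    rw [hM]
    refine hMcl.mono_left (Subfield.closure_le.2 ?_)
    have hsum : ∀ z, σ z - z ∈ nest σ K t lev n k → z ∈ gen P' t Y ⊔ M := fun z hz =>
      sup_le_sup le_gen (Subfield.closure_le.2 hMsum) (hP'sum z hz)
    rintro x (hx | ⟨j, ⟨hj, hjk⟩, rfl⟩)
    · exact hsum x hx
    · rcases T.sum_or_prod j with h | h
      · exact hsum _ (T.gen_lower_le_nest hj.le hjk.le h)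
      · exact (le_sup_left : gen P' t Y ≤ gen P' t Y ⊔ M) (mem_gen ⟨hj, hjk, h⟩)

theorem shiftClosed_gen_nest [CharZero F] (T : DepthTower σ K t lev) {i : ℕ} (hi : i ≤ n) (m : ℕ)
    {j : ℕ} (hj : j ≤ i) : ShiftClosed σ 1 (gen (nest σ K t lev n m) t {b | (b : ℕ) < j})
      (gen (nest σ K t lev i m) t {b | (b : ℕ) < j}) := by
  induction j with
  | zero =>
    have h0 : {b : Fin n | (b : ℕ) < 0} = ∅ := by ext; simp
    rw [h0, gen_empty, gen_empty]
    exact T.shiftClosed_nest hi m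
  | succ j ih =>
    have ih := ih (by omega)
    let a : Fin n := ⟨j, by omega⟩
    have hins : {b : Fin n | (b : ℕ) < j + 1} = insert a {b : Fin n | (b : ℕ) < j} := by
      ext b
      simp only [Set.mem_ofPred_eq, Set.mem_insert_iff, Fin.ext_iff, a]
      omega
    have hlow : ∀ (N : Subfield F), K ≤ N → ∀ b : Fin n, (b : ℕ) ≤ j →
        gen K t {c | c < b ∧ lev c < lev b} ≤ gen N t {b | (b : ℕ) < j} := fun N hN b hb =>
      gen_le (hN.trans le_gen) fun c hc => mem_gen (by
        have := hc.1
        change (c : ℕ) < j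
        omega)
    have hst : ∀ N : Subfield F, K ≤ N → Stable σ N → Stable σ (gen N t {b | (b : ℕ) < j}) :=
      fun N hN hNs => stable_gen_of_map_mem hNs fun b hb =>
        T.map_mem_of_lower_le (hlow N hN b (le_of_lt hb)) (mem_gen hb)
    have hQ := hst _ (T.base_le_nest n m) (T.stable_nest n m)
    have hR := hst _ (T.base_le_nest i m) (T.stable_nest i m)
    have hRQ := gen_mono_base (t := t) (nest_mono_left (σ := σ) (K := K) (t := t) (lev := lev) hi m)
      {b : Fin n | (b : ℕ) < j}
    rw [hins, gen_insert, gen_insert]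
    rcases T.sum_or_prod a with h | ⟨α, h, hα⟩
    · exact ih.adj_sum hQ hR
        (fun c h => hRQ (le_gen (T.base_le_nest i m (T.const_mem c h)))) hRQ
        (hlow _ (T.base_le_nest i m) a le_rfl h)
    -- A product of level at most m already belongs to both fields; a higher one lies outside the
    -- set B needed for `shiftClosed_adj_prod`.
    · by_cases hm : lev a ≤ m
      · have h1 : t a ∈ gen (nest σ K t lev i m) t {b | (b : ℕ) < j} :=
          le_gen (T.gen_mem_nest (by change j < i; omega) hm)
        rwa [adj_eq_self h1, adj_eq_self (hRQ h1)]
      · have hdown : ∀ i : ℕ, j ≤ i →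
            DownClosed lev ({b : Fin n | (b : ℕ) < i ∧ lev b ≤ m} ∪ {b | (b : ℕ) < j}) := by
          rintro i hi c (hc | hc) b hb hlev
          · exact Or.inl ⟨lt_trans hb hc.1, hlev.le.trans hc.2⟩
          · exact Or.inr (lt_trans (show (b : ℕ) < c from hb) hc)
        refine T.shiftClosed_adj_prod
          (A := {b : Fin n | (b : ℕ) < i ∧ lev b ≤ m} ∪ {b | (b : ℕ) < j})
          (B := {b : Fin n | (b : ℕ) < n ∧ lev b ≤ m} ∪ {b | (b : ℕ) < j})
          (Set.union_subset_union_left _ fun b hb => ⟨b.2, hb.2⟩) (hdown i (by omega))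
          (hdown n (by omega)) ?_
          (gen_mono (fun b hb => Or.inr (show (b : ℕ) < j from hb.1)) h) hα hQ hR hRQ ?_ ?_ ?_ ih
        · rintro (hb | hb)
          · exact hm hb.2
          · exact lt_irrefl j hb
        · refine gen_le ((T.base_le_nest i m).trans le_gen) ?_
          rintro b (hb | hb)
          · exact le_gen (T.gen_le_nest i m (mem_gen hb))
          · exact mem_gen hb
        · exact gen_le ((nest_le_sumClosure i m).trans
            (sumClosure_mono (gen_mono fun b hb => Or.inl hb)))
            fun b hb => le_sumClosure _ (mem_gen (Or.inr hb))
        · exact gen_le ((nest_le_sumClosure n m).trans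
            (sumClosure_mono (gen_mono fun b hb => Or.inl hb)))
            fun b hb => le_sumClosure _ (mem_gen (Or.inr hb))

end DepthTower

end NestedSums

end DiffField

namespace DiffField

/-! ### Redundant generators and independent lists of sums -/

section NestedSums

variable {F : Type v} [Field F]

/-- The generator `t_i` is a sum that can be expressed by nested sums, of depth smaller than that
of `t_i`, over the preceding generators. -/
def IsRedundant (σ : F ≃+* F) (K : Subfield F) {n : ℕ} (t : Fin n → F) (lev : Fin n → ℕ)
    (i : Fin n) : Prop :=
  σ (t i) - t i ∈ gen K t {b | b < i ∧ lev b < lev i} ∧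
    t i ∈ gen (nest σ K t lev i (lev i - 1)) t {b | (b : ℕ) < i}

/-- The subfield generated by the `t_b` with `b < i` and the elements of `l`, both of level at
most `k`. -/
def lowGen (K : Subfield F) {n : ℕ} (t : Fin n → F) (lev : Fin n → ℕ) (i : ℕ) (k : ℕ)
    (l : List (F × ℕ)) : Subfield F :=
  gen K t {b | (b : ℕ) < i ∧ lev b ≤ k} ⊔ Subfield.closure {s | ∃ k' ≤ k, (s, k') ∈ l}

/-- The subfield generated by the `t_b` with `b < i` and the elements of `l`. -/
def allGen (K : Subfield F) {n : ℕ} (t : Fin n → F) (i : ℕ) (l : List (F × ℕ)) : Subfield F :=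
  gen K t {b | (b : ℕ) < i} ⊔ Subfield.closure {s | ∃ k, (s, k) ∈ l}

/-- The subfield generated over the `k`-fold nested sums by the `t_b` with `b < i` and the
elements of `l`, both of level `k + 1`. -/
def levelGen (σ : F ≃+* F) (K : Subfield F) {n : ℕ} (t : Fin n → F) (lev : Fin n → ℕ) (i : ℕ)
    (k : ℕ) (l : List (F × ℕ)) : Subfield F :=
  gen (nest σ K t lev i k) t {b | (b : ℕ) < i ∧ lev b = k + 1} ⊔
    Subfield.closure {s | (s, k + 1) ∈ l}

/-- Lists of sums, with levels at most `m`, that are independent over the `t_b` with `b < i`. The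
head of the list is the sum that is adjoined last. -/
inductive GoodList (σ : F ≃+* F) (K : Subfield F) {n : ℕ} (t : Fin n → F) (lev : Fin n → ℕ) (i : ℕ)
    (m : ℕ) : List (F × ℕ) → Prop
  | nil : GoodList σ K t lev i m []
  | cons {b : F} {k : ℕ} {l : List (F × ℕ)} (hl : GoodList σ K t lev i m l) (hk : k < m)
      (hb : σ b - b ∈ lowGen K t lev i k l) (hbV : b ∉ levelGen σ K t lev i k l) :
      GoodList σ K t lev i m ((b, k + 1) :: l)

variable {σ : F ≃+* F} {K : Subfield F} {n : ℕ} {t : Fin n → F} {lev : Fin n → ℕ} {i m : ℕ}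
  {l l' : List (F × ℕ)}

theorem lowGen_mono (k : ℕ) (h : l ⊆ l') : lowGen K t lev i k l ≤ lowGen K t lev i k l' :=
  sup_le_sup_left (Subfield.closure_mono (by rintro _ ⟨k', hk', hs⟩; exact ⟨k', hk', h hs⟩)) _

theorem lowGen_mono_right {k k' : ℕ} (h : k ≤ k') :
    lowGen K t lev i k l ≤ lowGen K t lev i k' l :=
  sup_le_sup (gen_mono fun _ hb => And.intro hb.1 (hb.2.trans h))
    (Subfield.closure_mono (by rintro _ ⟨k'', hk'', hs⟩; exact ⟨k'', hk''.trans h, hs⟩))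

theorem allGen_mono (h : l ⊆ l') : allGen K t i l ≤ allGen K t i l' :=
  sup_le_sup_left (Subfield.closure_mono (by rintro _ ⟨k', hs⟩; exact ⟨k', h hs⟩)) _

theorem lowGen_le_allGen (k : ℕ) : lowGen K t lev i k l ≤ allGen K t i l :=
  sup_le_sup (gen_mono fun _ hb => hb.1) (Subfield.closure_mono (by
    rintro _ ⟨k', _, hs⟩; exact ⟨k', hs⟩))

theorem mem_lowGen_of_mem {b : F} {k k' : ℕ} (h : (b, k') ∈ l) (hk : k' ≤ k) :
    b ∈ lowGen K t lev i k l :=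
  (le_sup_right : _ ≤ lowGen K t lev i k l) (Subfield.subset_closure ⟨k', hk, h⟩)

namespace GoodList

theorem sub_mem_lowGen (h : GoodList σ K t lev i m l) {b : F} {k : ℕ} (hb : (b, k) ∈ l) :
    ∃ k', k = k' + 1 ∧ k' < m ∧ σ b - b ∈ lowGen K t lev i k' l := by
  induction h with
  | nil => simp at hb
  | @cons c k' l hl hk hc _ ih =>
    have hsub : l ⊆ (c, k' + 1) :: l := List.subset_cons_self _ _
    rcases List.mem_cons.1 hb with h | h
    · obtain ⟨rfl, rfl⟩ := Prod.mk.inj h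
      exact ⟨k', rfl, hk, lowGen_mono _ hsub hc⟩
    · obtain ⟨k'', h1, h2, h3⟩ := ih h
      exact ⟨k'', h1, h2, lowGen_mono _ hsub h3⟩

theorem lowGen_le_nest (T : DepthTower σ K t lev) (h : GoodList σ K t lev i m l) (k : ℕ) :
    lowGen K t lev i k l ≤ nest σ K t lev i k := by
  induction k with
  | zero =>
    refine sup_le (T.gen_le_nest i 0) (Subfield.closure_le.2 ?_)
    rintro s ⟨k', hk', hs⟩
    obtain ⟨k'', h1, -, -⟩ := h.sub_mem_lowGen hs
    omega
  | succ k ih =>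
    refine sup_le (T.gen_le_nest i (k + 1)) (Subfield.closure_le.2 ?_)
    rintro s ⟨k', hk', hs⟩
    obtain ⟨k'', h1, -, h2⟩ := h.sub_mem_lowGen hs
    exact DepthTower.sum_mem_nest (ih (lowGen_mono_right (by omega) h2))

theorem mem_nest (T : DepthTower σ K t lev) (h : GoodList σ K t lev i m l) {b : F} {k : ℕ}
    (hb : (b, k) ∈ l) : b ∈ nest σ K t lev i k :=
  h.lowGen_le_nest T k (mem_lowGen_of_mem hb le_rfl)

theorem stable_levelGen (T : DepthTower σ K t lev) (h : GoodList σ K t lev i m l) (k : ℕ) :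
    Stable σ (levelGen σ K t lev i k l) := by
  have hle : nest σ K t lev i k ≤ levelGen σ K t lev i k l := le_gen.trans le_sup_left
  refine sup_le (sup_le (fun x hx => hle (T.stable_nest i k hx)) (Subfield.closure_le.2 ?_))
    (Subfield.closure_le.2 fun s hs => ?_)
  · rintro _ ⟨a, ha, rfl⟩
    exact T.map_mem_of_lower_le ((T.gen_lower_le_nest ha.1.le ha.2.le).trans hle)
      ((le_sup_left : _ ≤ levelGen σ K t lev i k l) (mem_gen ha))
  · obtain ⟨k', h1, -, h2⟩ := h.sub_mem_lowGen hs
    obtain rfl : k = k' := by omega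
    have h3 := add_mem (hle (h.lowGen_le_nest T k h2))
      ((le_sup_right : _ ≤ levelGen σ K t lev i k l) (Subfield.subset_closure hs))
    rwa [sub_add_cancel] at h3

theorem transcendental_levelGen [CharZero F] (T : DepthTower σ K t lev)
    (h : GoodList σ K t lev i m l) {b : F} {k : ℕ} (hb : σ b - b ∈ lowGen K t lev i k l)
    (hbV : b ∉ levelGen σ K t lev i k l) : Transcendental (levelGen σ K t lev i k l) b := by
  have hle : nest σ K t lev i k ≤ levelGen σ K t lev i k l := le_gen.trans le_sup_left
  exact transcendental_of_sub_mem (h.stable_levelGen T k)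
    (fun c h => hle (T.base_le_nest i k (T.const_mem c h))) hbV (hle (h.lowGen_le_nest T k hb))

/-- Lists can be extended so as to capture the subfield generated by a set, if this is so for its
elements. -/
theorem exists_mem_of_closure (D : List (F × ℕ) → Subfield F) (hD : ∀ l l', l ⊆ l' → D l ≤ D l')
    {A : Set F} {l₀ : List (F × ℕ)}
    (h : ∀ a ∈ A, ∀ l, GoodList σ K t lev i m l → l₀ ⊆ l →
      ∃ l', GoodList σ K t lev i m l' ∧ l ⊆ l' ∧ a ∈ D l') {a : F} (ha : a ∈ Subfield.closure A) :
    ∀ l, GoodList σ K t lev i m l → l₀ ⊆ l →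
      ∃ l', GoodList σ K t lev i m l' ∧ l ⊆ l' ∧ a ∈ D l' := by
  induction ha using Subfield.closure_induction with
  | mem x hx => exact h x hx
  | one => exact fun l hl _ => ⟨l, hl, List.Subset.refl l, one_mem _⟩
  | neg x _ ih =>
    intro l hl hl₀
    obtain ⟨l', h1, h2, h3⟩ := ih l hl hl₀
    exact ⟨l', h1, h2, neg_mem h3⟩
  | inv x _ ih =>
    intro l hl hl₀
    obtain ⟨l', h1, h2, h3⟩ := ih l hl hl₀
    exact ⟨l', h1, h2, inv_mem h3⟩
  | add x y _ _ ihx ihy =>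
    intro l hl hl₀
    obtain ⟨l', h1, h2, h3⟩ := ihx l hl hl₀
    obtain ⟨l'', h1', h2', h3'⟩ := ihy l' h1 (List.Subset.trans hl₀ h2)
    exact ⟨l'', h1', List.Subset.trans h2 h2', add_mem (hD _ _ h2' h3) h3'⟩
  | mul x y _ _ ihx ihy =>
    intro l hl hl₀
    obtain ⟨l', h1, h2, h3⟩ := ihx l hl hl₀
    obtain ⟨l'', h1', h2', h3'⟩ := ihy l' h1 (List.Subset.trans hl₀ h2)
    exact ⟨l'', h1', List.Subset.trans h2 h2', mul_mem (hD _ _ h2' h3) h3'⟩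

/-- A new sum x over level k is appended to the list if it lies outside `levelGen`. Otherwise it is
a rational expression in elements of level k + 1 already present and finitely many elements of the
k-fold nested sums, which are captured by induction. -/
theorem exists_mem_lowGen {k : ℕ} (hk : k ≤ m) : ∀ a ∈ nest σ K t lev i k, ∀ l,
    GoodList σ K t lev i m l →
      ∃ l', GoodList σ K t lev i m l' ∧ l ⊆ l' ∧ a ∈ lowGen K t lev i k l' := by
  induction k with
  | zero => exact fun a ha l hl => ⟨l, hl, List.Subset.refl l, le_gen.trans le_sup_left ha⟩
  | succ k ih =>
    have ih := ih (by omega)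
    have hgen : ∀ (j : Fin n) l, (j : ℕ) < i ∧ lev j = k + 1 → t j ∈ lowGen K t lev i (k + 1) l :=
      fun j l hj => (le_sup_left : _ ≤ lowGen K t lev i (k + 1) l) (mem_gen ⟨hj.1, hj.2.le⟩)
    intro a ha l hl
    refine exists_mem_of_closure (l₀ := l) (fun l => lowGen K t lev i (k + 1) l)
      (fun _ _ => lowGen_mono _) ?_ ha l hl (List.Subset.refl l)
    rintro x (hx | ⟨j, hj, rfl⟩) l hl -
    · obtain ⟨l₁, hl₁, hll₁, hx₁⟩ := ih _ hx l hl
      by_cases hxV : x ∈ levelGen σ K t lev i k l₁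
      · have hxV' : x ∈ Subfield.closure ((nest σ K t lev i k : Set F) ∪
            (t '' {b | (b : ℕ) < i ∧ lev b = k + 1} ∪ {s | (s, k + 1) ∈ l₁})) := by
          refine (sup_le (sup_le (fun y hy => Subfield.subset_closure (Or.inl hy)) ?_) ?_ :
            levelGen σ K t lev i k l₁ ≤ _) hxV
          · exact Subfield.closure_mono fun y hy => Or.inr (Or.inl hy)
          · exact Subfield.closure_mono fun y hy => Or.inr (Or.inr hy)
        obtain ⟨l₂, h1, h2, h3⟩ := exists_mem_of_closure (l₀ := l₁)
          (fun l => lowGen K t lev i (k + 1) l) (fun _ _ => lowGen_mono _) (by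
            rintro y (hy | ⟨j, hj, rfl⟩ | hy) l hl hl₁
            · obtain ⟨l', h1, h2, h3⟩ := ih y hy l hl
              exact ⟨l', h1, h2, lowGen_mono_right (Nat.le_succ k) h3⟩
            · exact ⟨l, hl, List.Subset.refl l, hgen j l hj⟩
            · exact ⟨l, hl, List.Subset.refl l, mem_lowGen_of_mem (hl₁ hy) le_rfl⟩)
          hxV' l₁ hl₁ (List.Subset.refl l₁)
        exact ⟨l₂, h1, List.Subset.trans hll₁ h2, h3⟩
      · exact ⟨_, hl₁.cons (by omega) hx₁ hxV, List.Subset.trans hll₁ (List.subset_cons_self _ _),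
          mem_lowGen_of_mem (List.mem_cons_self) le_rfl⟩
    · exact ⟨l, hl, List.Subset.refl l, hgen j l hj⟩

end GoodList

namespace DepthTower

/-- A sum is transcendental unless it lies in the field, and then shift-closedness moves it from
stage n to stage j, which is redundancy. A product is transcendental over the sum closure of
generators other than itself, and that closure contains the field. -/
theorem transcendental_gen_nest [CharZero F] (T : DepthTower σ K t lev) {j : Fin n}
    (hj : ¬ IsRedundant σ K t lev j) :
    Transcendental (gen (nest σ K t lev n (lev j - 1)) t {b | (b : ℕ) < j}) (t j) := by
  set p := lev j - 1 with hp
  have hpos := T.lev_pos j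
  rcases T.sum_or_prod j with h | ⟨α, h, hα⟩
  · have hlow : ∀ N : Subfield F, K ≤ N → gen K t {b | b < j ∧ lev b < lev j} ≤
        gen N t {b | (b : ℕ) < j} := fun N hN =>
      (gen_mono_base hN _).trans (gen_mono fun b hb => hb.1)
    have hK := T.base_le_nest n p
    refine transcendental_of_sub_mem (stable_gen_of_map_mem (T.stable_nest n p) fun b hb =>
      T.map_mem_of_lower_le ((gen_mono_base hK _).trans (gen_mono fun c hc =>
        lt_trans hc.1 hb)) (mem_gen hb)) (fun c h => le_gen (hK (T.const_mem c h))) (fun hmem => ?_)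
        (hlow _ hK h)
    exact hj ⟨h, shiftClosed_one_iff.1 (T.shiftClosed_gen_nest j.2.le p le_rfl) _ hmem
      (hlow _ (T.base_le_nest j p) h)⟩
  · let B : Set (Fin n) := {b | (b : ℕ) < n ∧ lev b ≤ p} ∪ {b | (b : ℕ) < j}
    have hB : DownClosed lev B := by
      rintro c (hc | hc) b hb hlev
      · exact Or.inl ⟨b.2, hlev.le.trans hc.2⟩
      · exact Or.inr (lt_trans (show (b : ℕ) < c from hb) hc)
    have hjB : j ∉ B := by
      rintro (hb | hb)
      · have := hb.2
        omega
      · exact lt_irrefl (j : ℕ) hb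
    refine transcendental_mono ?_ (T.transcendental_sumClosure hB hjB
      (gen_mono (fun b hb => Or.inr hb.1) h) hα)
    exact gen_le ((nest_le_sumClosure n p).trans (sumClosure_mono (gen_mono fun b hb => Or.inl hb)))
      fun b hb => le_sumClosure _ (mem_gen (Or.inr hb))

/-- The generator of highest index among those of level p + 1 is transcendental over a field
containing x and the remaining data, so `mem_of_transcendental` removes it from x. -/
theorem mem_of_mem_gen_level [CharZero F] (T : DepthTower σ K t lev)
    (hi : ∀ j : Fin n, (j : ℕ) < i → ¬ IsRedundant σ K t lev j) {N : Subfield F} {p : ℕ}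
    (hN : N ≤ nest σ K t lev n p) {x : F} (hx : x ∈ nest σ K t lev n p)
    (hxN : x ∈ gen N t {b | (b : ℕ) < i ∧ lev b = p + 1}) : x ∈ N := by
  induction i with
  | zero =>
    have h0 : {b : Fin n | (b : ℕ) < 0 ∧ lev b = p + 1} = ∅ := by ext; simp
    rwa [h0, gen_empty] at hxN
  | succ i ih =>
    apply ih fun j hj => hi j (by omega)
    by_cases hl : ∃ a : Fin n, (a : ℕ) = i ∧ lev a = p + 1
    · obtain ⟨a, hai, hap⟩ := hl
      have hins : {b : Fin n | (b : ℕ) < i + 1 ∧ lev b = p + 1} =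
          insert a {b : Fin n | (b : ℕ) < i ∧ lev b = p + 1} := by
        ext b
        simp only [Set.mem_ofPred_eq, Set.mem_insert_iff, Fin.ext_iff]
        constructor
        · rintro ⟨h1, h2⟩
          by_cases hb : (b : ℕ) = a
          · exact Or.inl hb
          · exact Or.inr ⟨by omega, h2⟩
        · rintro (h | ⟨h1, h2⟩)
          · obtain rfl : b = a := Fin.ext h
            exact ⟨by omega, hap⟩
          · exact ⟨by omega, h2⟩
      rw [hins, gen_insert] at hxN
      have htr := T.transcendental_gen_nest (hi a (by omega))
      rw [show lev a - 1 = p by omega] at htr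
      refine mem_of_transcendental ?_ htr hxN (le_gen hx)
      exact (gen_mono_base hN _).trans (gen_mono fun b hb => by
        change (b : ℕ) < a
        have := hb.1
        omega)
    · have : {b : Fin n | (b : ℕ) < i + 1 ∧ lev b = p + 1} =
          {b : Fin n | (b : ℕ) < i ∧ lev b = p + 1} := by
        ext b
        constructor
        · rintro ⟨h1, h2⟩
          refine ⟨?_, h2⟩
          by_contra h3
          exact hl ⟨b, by omega, h2⟩
        · rintro ⟨h1, h2⟩
          exact ⟨by omega, h2⟩
      rwa [this] at hxN

theorem mem_gen_of_sub_mem [CharZero F] (T : DepthTower σ K t lev)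
    (hno : ∀ j, ¬ IsRedundant σ K t lev j) {d : ℕ} {g : F} (hg : g ∈ gen K t Set.univ)
    (hΔ : σ g - g ∈ gen K t {b | lev b ≤ d}) : g ∈ gen K t {b | lev b ≤ d + 1} := by
  have hgd : ∀ k, d + 1 ≤ k → g ∈ nest σ K t lev n k := fun k hk =>
    T.nest_mono_right n hk (sum_mem_nest (T.gen_le_nest n d
      (gen_mono (B := {b : Fin n | (b : ℕ) < n ∧ lev b ≤ d}) (fun b hb => ⟨b.2, hb⟩) hΔ)))
  have hstep : ∀ k, g ∈ gen K t {b | lev b ≤ d + 1 + k} → g ∈ gen K t {b | lev b ≤ d + 1} := by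
    intro k
    induction k with
    | zero => exact id
    | succ k ih =>
      intro h
      apply ih
      refine T.mem_of_mem_gen_level (i := n) (fun j _ => hno j) (p := d + 1 + k)
        ((gen_mono fun b hb => ?_).trans (T.gen_le_nest n (d + 1 + k))) (hgd _ (by omega)) ?_
      · exact ⟨b.2, hb⟩
      · refine (gen_le (le_gen.trans le_gen) ?_ : gen K t {b | lev b ≤ d + 1 + (k + 1)} ≤ _) h
        intro b hb
        have hb : lev b ≤ d + 1 + (k + 1) := hb
        by_cases h1 : lev b ≤ d + 1 + k
        · exact le_gen (mem_gen h1)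
        · exact mem_gen ⟨b.2, by omega⟩
  -- This many steps down from the top suffice: no generator has level above d + 1 plus this number.
  apply hstep (Finset.univ.sup lev)
  refine gen_mono (fun b _ => ?_) hg
  have := Finset.le_sup (f := lev) (Finset.mem_univ b)
  change lev b ≤ _
  omega

end DepthTower

namespace GoodList

/-- The head of the list was adjoined last. If its level is p + 1, it is transcendental over a field
containing x and everything of that level adjoined before, so it can be removed; when the list is
used up, the generators follow by `mem_of_mem_gen_level`. -/
theorem mem_of_mem_level [CharZero F] (T : DepthTower σ K t lev) (hin : i ≤ n)
    (hi : ∀ j : Fin n, (j : ℕ) < i → ¬ IsRedundant σ K t lev j) (h : GoodList σ K t lev i m l)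
    {N : Subfield F} {p : ℕ} (hN : N ≤ nest σ K t lev i p) {x : F} (hx : x ∈ nest σ K t lev i p)
    (hxN : x ∈ gen N t {b | (b : ℕ) < i ∧ lev b = p + 1} ⊔ Subfield.closure {s | (s, p + 1) ∈ l}) :
    x ∈ N := by
  induction h with
  | nil =>
    have h0 : {s : F | (s, p + 1) ∈ ([] : List (F × ℕ))} = ∅ := by ext; simp
    rw [h0, Subfield.closure_empty, sup_bot_eq] at hxN
    exact T.mem_of_mem_gen_level hi (hN.trans (DepthTower.nest_mono_left hin p))
      (DepthTower.nest_mono_left hin p hx) hxN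
  | @cons b k l hl hk hb hbV ih =>
    by_cases hpk : p = k
    · subst hpk
      have hset : {s : F | (s, p + 1) ∈ (b, p + 1) :: l} = insert b {s : F | (s, p + 1) ∈ l} := by
        ext s; simp
      have hins : gen N t {b | (b : ℕ) < i ∧ lev b = p + 1} ⊔
          Subfield.closure {s | (s, p + 1) ∈ (b, p + 1) :: l} =
          adj (gen N t {b | (b : ℕ) < i ∧ lev b = p + 1} ⊔
            Subfield.closure {s | (s, p + 1) ∈ l}) b := by
        rw [hset, Set.insert_eq, Subfield.closure_union, adj, sup_assoc,
          sup_comm (Subfield.closure {b})]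
      rw [hins] at hxN
      refine ih (mem_of_transcendental ?_ (hl.transcendental_levelGen T hb hbV) hxN ?_)
      · exact sup_le_sup_right (gen_mono_base hN _) _
      · exact le_gen.trans le_sup_left hx
    · have hset : {s : F | (s, p + 1) ∈ (b, k + 1) :: l} = {s : F | (s, p + 1) ∈ l} := by
        ext s; simp [hpk]
      rw [hset] at hxN
      exact ih hxN

/-- `GoodList` asks only for independence within one level. It implies full independence: b is a
(k+1)-fold nested sum, so everything of level above k + 1 can be removed from an expression for b,
highest level first, and what remains lies in `levelGen`. -/
theorem not_mem_allGen [CharZero F] (T : DepthTower σ K t lev) (hin : i ≤ n)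
    (hi : ∀ j : Fin n, (j : ℕ) < i → ¬ IsRedundant σ K t lev j) (h : GoodList σ K t lev i m l)
    {b : F} {k : ℕ} (hb : σ b - b ∈ lowGen K t lev i k l)
    (hbV : b ∉ levelGen σ K t lev i k l) : b ∉ allGen K t i l := by
  intro hmem
  let U : ℕ → Subfield F := fun q => levelGen σ K t lev i k l ⊔ lowGen K t lev i q l
  have hbn : b ∈ nest σ K t lev i (k + 1) :=
    DepthTower.sum_mem_nest (h.lowGen_le_nest T k hb)
  have hV : levelGen σ K t lev i k l ≤ nest σ K t lev i (k + 1) := by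
    refine sup_le (gen_le (T.nest_le_succ i k) fun a ha => T.gen_mem_nest ha.1 ha.2.le)
      (Subfield.closure_le.2 fun s hs => h.mem_nest T hs)
  have hU0 : U (k + 1) ≤ levelGen σ K t lev i k l := by
    have hn : nest σ K t lev i k ≤ levelGen σ K t lev i k l := le_gen.trans le_sup_left
    refine sup_le le_rfl (sup_le (gen_le ((T.base_le_nest i k).trans hn) ?_)
      (Subfield.closure_le.2 ?_))
    · rintro a ⟨ha, hak⟩
      by_cases hk : lev a ≤ k
      · exact hn (T.gen_mem_nest ha hk)
      · exact (le_sup_left : _ ≤ levelGen σ K t lev i k l) (mem_gen ⟨ha, by omega⟩)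
    · rintro s ⟨k', hk', hs⟩
      by_cases hk : k' ≤ k
      · exact hn (T.nest_mono_right i hk (h.mem_nest T hs))
      · obtain rfl : k' = k + 1 := by omega
        exact (le_sup_right : _ ≤ levelGen σ K t lev i k l) (Subfield.subset_closure hs)
  have hstep : ∀ q, b ∉ U (k + 1 + q) := by
    intro q
    induction q with
    | zero => exact fun hb' => hbV (hU0 hb')
    | succ q ih =>
      intro hb'
      refine ih (h.mem_of_mem_level T hin hi (p := k + 1 + q)
        (sup_le (hV.trans (T.nest_mono_right i (by omega))) (h.lowGen_le_nest T _))
        (T.nest_mono_right i (by omega) hbn) ?_)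
      have hle : U (k + 1 + q) ≤ gen (U (k + 1 + q)) t
          {b | (b : ℕ) < i ∧ lev b = k + 1 + q + 1} ⊔
            Subfield.closure {s | (s, k + 1 + q + 1) ∈ l} := le_gen.trans le_sup_left
      refine sup_le (le_sup_left.trans hle) (sup_le (gen_le ?_ ?_) (Subfield.closure_le.2 ?_)) hb'
      · exact (le_gen.trans le_sup_left).trans (le_sup_right.trans hle)
      · rintro a ⟨ha, hak⟩
        by_cases hk : lev a ≤ k + 1 + q
        · exact hle ((le_sup_right : _ ≤ U (k + 1 + q))
            ((le_sup_left : _ ≤ lowGen K t lev i (k + 1 + q) l) (mem_gen ⟨ha, hk⟩)))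
        · exact (le_sup_left : gen (U (k + 1 + q)) t _ ≤ _) (mem_gen ⟨ha, by omega⟩)
      · rintro s ⟨k', hk', hs⟩
        by_cases hk : k' ≤ k + 1 + q
        · exact hle ((le_sup_right : _ ≤ U (k + 1 + q)) (mem_lowGen_of_mem hs hk))
        · obtain rfl : k' = k + 1 + q + 1 := by omega
          exact (le_sup_right : Subfield.closure {s | (s, k + 1 + q + 1) ∈ l} ≤ _)
            (Subfield.subset_closure hs)
  -- The number bounds the levels of all generators and of all members of the list.
  refine hstep (Finset.univ.sup lev + m) ((le_sup_right : _ ≤ U _) ?_)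
  refine (sup_le_sup (gen_mono fun a ha => And.intro ha ?_) (Subfield.closure_mono ?_) :
    allGen K t i l ≤ lowGen K t lev i (k + 1 + (Finset.univ.sup lev + m)) l) hmem
  · have := Finset.le_sup (f := lev) (Finset.mem_univ a)
    omega
  · rintro s ⟨k', hs⟩
    obtain ⟨k'', h1, h2, -⟩ := h.sub_mem_lowGen hs
    exact ⟨k', by omega, hs⟩

end GoodList

theorem IsRedundant.exists_goodList {j : Fin n} (h : IsRedundant σ K t lev j) :
    ∃ l, GoodList σ K t lev j (lev j - 1) l ∧ t j ∈ allGen K t j l := by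
  have h1 : t j ∈ Subfield.closure ((nest σ K t lev j (lev j - 1) : Set F) ∪
      t '' {b | (b : ℕ) < j}) :=
    (sup_le (fun y hy => Subfield.subset_closure (Or.inl hy))
      (Subfield.closure_mono fun y hy => Or.inr hy) :
      gen (nest σ K t lev j (lev j - 1)) t {b | (b : ℕ) < j} ≤ _) h.2
  obtain ⟨l, hl, -, hjl⟩ := GoodList.exists_mem_of_closure (l₀ := [])
    (fun l => allGen K t j l) (fun _ _ => allGen_mono) (by
      rintro y (hy | ⟨b, hb, rfl⟩) l hl -
      · obtain ⟨l', h1, h2, h3⟩ := GoodList.exists_mem_lowGen le_rfl y hy l hl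
        exact ⟨l', h1, h2, lowGen_le_allGen _ h3⟩
      · exact ⟨l, hl, List.Subset.refl l,
          (le_sup_left : _ ≤ allGen K t j l) (mem_gen hb)⟩) h1 [] GoodList.nil
      (List.Subset.refl _)
  exact ⟨l, hl, hjl⟩

end NestedSums

end DiffField

namespace DiffField

/-! ### Occurrence of variables and depth -/

section Occurs

variable {G : Type u} {E : Type v} [Field G] [Field E] [Algebra G E] {n : ℕ} {t : Fin n → E}

theorem vars_subset_of_dvd {p q : MvPolynomial (Fin n) G} (h : p ∣ q) (hq : q ≠ 0) :
    p.vars ⊆ q.vars := by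
  obtain ⟨r, rfl⟩ := h
  intro j hj
  rw [MvPolynomial.mem_vars_iff_degreeOf_ne_zero] at hj ⊢
  rw [MvPolynomial.degreeOf_mul_eq (left_ne_zero_of_mul hq) (right_ne_zero_of_mul hq)]
  omega

theorem mem_adjoin_image_iff {A : Set (Fin n)} {x : E} :
    x ∈ IntermediateField.adjoin G (t '' A) ↔ ∃ p q : MvPolynomial (Fin n) G,
      (p.vars : Set (Fin n)) ⊆ A ∧ (q.vars : Set (Fin n)) ⊆ A ∧ MvPolynomial.aeval t q ≠ 0 ∧
        x = MvPolynomial.aeval t p / MvPolynomial.aeval t q := by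
  have h : Algebra.adjoin G (t '' A) =
      (MvPolynomial.supported G A).map (MvPolynomial.aeval t) := by
    rw [MvPolynomial.supported, AlgHom.map_adjoin, Set.image_image]
    simp
  rw [IntermediateField.mem_adjoin_iff_div, h]
  constructor
  · rintro ⟨_, ⟨p, hp, rfl⟩, _, ⟨q, hq, rfl⟩, rfl⟩
    by_cases h0 : MvPolynomial.aeval t q = 0
    · refine ⟨0, 1, by simp, by simp, by simp, ?_⟩
      change MvPolynomial.aeval t p / MvPolynomial.aeval t q = _
      simp [h0]
    · exact ⟨p, q, MvPolynomial.mem_supported.1 hp, MvPolynomial.mem_supported.1 hq, h0, rfl⟩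
  · rintro ⟨p, q, hp, hq, -, rfl⟩
    exact ⟨_, ⟨p, MvPolynomial.mem_supported.2 hp, rfl⟩, _,
      ⟨q, MvPolynomial.mem_supported.2 hq, rfl⟩, rfl⟩

/-- A coprime numerator and denominator divide those of any other representation, so their variables
appear in every representation. In particular, the choice of coprime fraction does not matter. -/
theorem Occurs.mem (ht : AlgebraicIndependent G t) {A : Set (Fin n)} {x : E}
    (hx : x ∈ IntermediateField.adjoin G (t '' A)) {j : Fin n} (hj : Occurs G t x j) : j ∈ A := by
  obtain ⟨p, q, hpq, hq, rfl, hj⟩ := hj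
  obtain ⟨p', q', hp', hq', hq'0, heq⟩ := mem_adjoin_image_iff.1 hx
  have hinj : Function.Injective (MvPolynomial.aeval t : MvPolynomial (Fin n) G →ₐ[G] E) := ht
  rw [div_eq_div_iff hq hq'0, ← map_mul, ← map_mul] at heq
  have heq := hinj heq
  have hq'ne : q' ≠ 0 := by rintro rfl; simp at hq'0
  have hqdvd : q ∣ q' := hpq.symm.dvd_of_dvd_mul_left (heq ▸ dvd_mul_left q p')
  have hpdvd : p ∣ p' := hpq.dvd_of_dvd_mul_right (heq ▸ dvd_mul_right p q')
  rcases hj with hj | hj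
  · by_cases hp'0 : p' = 0
    · have : p = 0 := by
        have h1 : p * q' = 0 := by rw [heq, hp'0, zero_mul]
        exact (mul_eq_zero.1 h1).resolve_right hq'ne
      simp [this] at hj
    · exact hp' (vars_subset_of_dvd hpdvd hp'0 hj)
  · exact hq' (vars_subset_of_dvd hqdvd hq'ne hj)

theorem mem_adjoin_occurs {x : E} (hx : x ∈ IntermediateField.adjoin G (t '' Set.univ)) :
    x ∈ IntermediateField.adjoin G (t '' {j | Occurs G t x j}) := by
  obtain ⟨p, q, -, -, hq0, hx⟩ := mem_adjoin_image_iff.1 hx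
  have hq : q ≠ 0 := by rintro rfl; simp at hq0
  obtain ⟨q', p', c, hrel, rfl, rfl⟩ := UniqueFactorizationMonoid.exists_reduced_factors q hq p
  rw [map_mul] at hq0
  have hc := left_ne_zero_of_mul hq0
  have hq' := right_ne_zero_of_mul hq0
  rw [map_mul, map_mul, mul_div_mul_left _ _ hc] at hx
  exact mem_adjoin_image_iff.2 ⟨p', q', fun j hj => ⟨p', q', hrel.symm, hq', hx, Or.inl hj⟩,
    fun j hj => ⟨p', q', hrel.symm, hq', hx, Or.inr hj⟩, hq', hx⟩

variable {σ : E ≃+* E}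

open Classical in
theorem genDepth_eq (i : Fin n) : genDepth G σ t i =
    (Finset.univ.filter fun j : Fin n =>
      j < i ∧ Occurs G t (shiftCoeff σ (stage G t i) (t i)) j).sup (genDepth G σ t) + 1 := by
  rw [genDepth, Finset.sup_attach]

theorem genDepth_pos (i : Fin n) : 0 < genDepth G σ t i := by
  rw [genDepth_eq]; omega

theorem genDepth_lt {i j : Fin n} (hji : j < i)
    (h : Occurs G t (shiftCoeff σ (stage G t i) (t i)) j) :
    genDepth G σ t j < genDepth G σ t i := by
  classical
  rw [genDepth_eq i, Nat.lt_succ_iff]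
  exact Finset.le_sup (f := genDepth G σ t) (Finset.mem_filter.2 ⟨Finset.mem_univ j, hji, h⟩)

theorem genDepth_le_of_occurs {i : Fin n} {k : ℕ} (hk : 0 < k)
    (h : ∀ j, Occurs G t (shiftCoeff σ (stage G t i) (t i)) j → genDepth G σ t j < k) :
    genDepth G σ t i ≤ k := by
  classical
  rw [genDepth_eq, Nat.succ_le_iff, Finset.sup_lt_iff (by simpa using hk)]
  exact fun j hj => h j (Finset.mem_filter.1 hj).2.2

theorem genDepth_le_depth_shiftCoeff (i : Fin n) :
    genDepth G σ t i ≤ depth G σ t (shiftCoeff σ (stage G t i) (t i)) + 1 := by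
  classical
  rw [genDepth_eq, depth]
  refine Nat.succ_le_succ (Finset.sup_mono fun j hj => ?_)
  exact Finset.mem_filter.2 ⟨Finset.mem_univ j, (Finset.mem_filter.1 hj).2.2⟩

/-- This turns depth bounds into membership in subfields, the only form in which the field-theoretic
argument uses depth. -/
theorem depth_le_iff (ht : AlgebraicIndependent G t)
    (htop : IntermediateField.adjoin G (t '' Set.univ) = ⊤) {x : E} {k : ℕ} :
    depth G σ t x ≤ k ↔ x ∈ IntermediateField.adjoin G (t '' {j | genDepth G σ t j ≤ k}) := by
  classical
  constructor
  · intro h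
    have hx : x ∈ IntermediateField.adjoin G (t '' Set.univ) := by rw [htop]; trivial
    refine IntermediateField.adjoin.mono _ _ _ (Set.image_mono fun j hj => ?_)
      (mem_adjoin_occurs hx)
    exact (Finset.le_sup (f := genDepth G σ t)
      (Finset.mem_filter.2 ⟨Finset.mem_univ j, hj⟩)).trans h
  · intro hx
    exact Finset.sup_le fun j hj => Occurs.mem ht hx (Finset.mem_filter.1 hj).2

theorem shiftCoeff_of_sum {L : IntermediateField G E} {x : E} (h : σ x - x ∈ L) :
    shiftCoeff σ L x = σ x - x :=
  if_pos h

theorem shiftCoeff_of_prod {L : IntermediateField G E} (hc : ∀ c, σ c = c → c ∈ L) {x α : E}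
    (hx : x ∉ L) (hα : α ∈ L) (h : σ x = α * x) : shiftCoeff σ L x = α := by
  have hx0 : x ≠ 0 := by rintro rfl; exact hx (zero_mem L)
  have hnot : σ x - x ∉ L := by
    intro hmem
    have h1 : (α - 1) * x ∈ L := by rwa [sub_mul, one_mul, ← h]
    by_cases hα1 : α - 1 = 0
    · exact hx (hc x (by rw [h, sub_eq_zero.1 hα1, one_mul]))
    · have := L.div_mem h1 (L.sub_mem hα L.one_mem)
      rw [mul_div_cancel_left₀ _ hα1] at this
      exact hx this
  rw [shiftCoeff, if_neg hnot, h, mul_div_cancel_right₀ _ hx0]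

end Occurs

/-! ### Depth in a field embedded in F -/

section Transfer

theorem map_mem_of_mem_adjoin {G E F : Type*} [Field G] [Field E] [Field F] [Algebra G E]
    (f : E →+* F) {S : Set E}
    {M : Subfield F} (hG : ∀ c : G, f (algebraMap G E c) ∈ M) (hS : ∀ s ∈ S, f s ∈ M) {x : E}
    (hx : x ∈ IntermediateField.adjoin G S) : f x ∈ M := by
  refine (Subfield.closure_le.2 (Set.union_subset ?_ hS) :
    (IntermediateField.adjoin G S).toSubfield ≤ M.comap f) hx
  rintro _ ⟨c, rfl⟩
  exact hG c

variable {G : Type u} {F : Type v} [Field G] [Field F] [Algebra G F]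

theorem mem_gen_fieldRange_iff {n : ℕ} {t : Fin n → F} {A : Set (Fin n)} {x : F} :
    x ∈ gen (algebraMap G F).fieldRange t A ↔ x ∈ IntermediateField.adjoin G (t '' A) := by
  constructor
  · intro hx
    refine (gen_le ?_ ?_ : gen (algebraMap G F).fieldRange t A ≤
      (IntermediateField.adjoin G (t '' A)).toSubfield) hx
    · rintro _ ⟨c, rfl⟩
      exact (IntermediateField.adjoin G (t '' A)).algebraMap_mem c
    · exact fun a ha => IntermediateField.subset_adjoin G _ ⟨a, ha, rfl⟩
  · intro hx
    refine (Subfield.closure_le.2 (Set.union_subset ?_ ?_) :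
      (IntermediateField.adjoin G (t '' A)).toSubfield ≤ gen (algebraMap G F).fieldRange t A) hx
    · rintro _ ⟨c, rfl⟩
      exact le_gen ⟨c, rfl⟩
    · rintro _ ⟨a, ha, rfl⟩
      exact mem_gen ha

theorem mem_adjoin_of_map_mem {E : Type*} [Field E] [Algebra G E] (f : E →ₐ[G] F) {S : Set E}
    {x : E} (h : f x ∈ IntermediateField.adjoin G (f '' S)) : x ∈ IntermediateField.adjoin G S := by
  rw [← IntermediateField.adjoin_map] at h
  obtain ⟨y, hy, hxy⟩ := h
  rwa [← f.injective hxy]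

variable {σ : F ≃+* F} {n : ℕ}

/-- The coefficient of a generator lies in the field of preceding generators of smaller level, so
only these occur in it; induct on the index. Levels may exceed depths, so a sum may be listed with
any admissible level. -/
theorem DepthTower.genDepth_le {E : Type v} [Field E] [Algebra G E] (f : E →ₐ[G] F)
    {σE : E ≃+* E} (hσ : ∀ x, f (σE x) = σ (f x)) {t : Fin n → E} {lev : Fin n → ℕ}
    (T : DepthTower σ (algebraMap G F).fieldRange (fun j => f (t j)) lev) (i : Fin n) :
    genDepth G σE t i ≤ lev i := by
  have ht : AlgebraicIndependent G t := (AlgHom.algebraicIndependent_iff f f.injective).1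
    (T.algebraicIndependent fun c => ⟨c, rfl⟩)
  have hmem : ∀ (x : E) (A : Set (Fin n)),
      f x ∈ gen (algebraMap G F).fieldRange (fun j => f (t j)) A →
        x ∈ IntermediateField.adjoin G (t '' A) := by
    intro x A hx
    apply mem_adjoin_of_map_mem f
    rw [Set.image_image]
    exact mem_gen_fieldRange_iff.1 hx
  have hstage : ∀ (x : E) (i : Fin n),
      f x ∈ gen (algebraMap G F).fieldRange (fun j => f (t j)) {b | b < i} → x ∈ stage G t i :=
    fun x i hx => hmem x _ hx
  have hcoeff : ∀ i, f (shiftCoeff σE (stage G t i) (t i)) ∈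
      gen (algebraMap G F).fieldRange (fun j => f (t j)) {b | b < i ∧ lev b < lev i} := by
    intro i
    have hlow : gen (algebraMap G F).fieldRange (fun j => f (t j)) {b | b < i ∧ lev b < lev i} ≤
        gen (algebraMap G F).fieldRange (fun j => f (t j)) {b | b < i} :=
      gen_mono fun b hb => hb.1
    rcases T.sum_or_prod i with h | ⟨α, h, hα⟩
    · have h1 : f (σE (t i) - t i) = σ (f (t i)) - f (t i) := by rw [map_sub, hσ]
      rw [shiftCoeff_of_sum (hstage _ i (by rw [h1]; exact hlow h)), h1]
      exact h
    · have hα' : f (σE (t i) / t i) = α := by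
        rw [map_div₀, hσ, hα, mul_div_cancel_right₀ _ (T.ne_zero i)]
      have hti0 : t i ≠ 0 := fun h => T.ne_zero i (by simp [h])
      rw [shiftCoeff_of_prod (α := σE (t i) / t i), hα']
      · exact h
      · intro c hc
        obtain ⟨d, hd⟩ := T.const_mem (f c) (by rw [← hσ, hc])
        exact hstage c i (le_gen ⟨d, hd⟩)
      · intro hti
        apply T.transcendental i
        have h2 : f (t i) ∈ gen (algebraMap G F).fieldRange (fun j => f (t j)) {b | b < i} := by
          refine map_mem_of_mem_adjoin (G := G) (f : E →+* F) (fun c => ?_) ?_ hti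
          · exact le_gen (show _ ∈ (algebraMap G F).fieldRange from ⟨c, (f.commutes c).symm⟩)
          · rintro _ ⟨b, hb, rfl⟩
            exact mem_gen hb
        exact isAlgebraic_algebraMap (⟨_, h2⟩ : gen (algebraMap G F).fieldRange _ {b | b < i})
      · exact hstage _ i (by rw [hα']; exact hlow h)
      · rw [div_mul_cancel₀ _ hti0]
  induction i using WellFoundedLT.induction with
  | ind i ih =>
    refine genDepth_le_of_occurs (T.lev_pos i) fun j hj => ?_
    have hji := Occurs.mem ht (hmem _ _ (hcoeff i)) hj
    exact (ih j hji.1).trans_lt hji.2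

end Transfer

end DiffField

namespace DiffField

/-! ### From lists of sums to towers -/

section Tuples

variable {F : Type v} [Field F] {σ : F ≃+* F} {K : Subfield F} {n : ℕ} {t : Fin n → F}
  {lev : Fin n → ℕ}

theorem gen_image {m : ℕ} (e : Fin m → Fin n) (A : Set (Fin m)) :
    gen K t (e '' A) = gen K (fun j => t (e j)) A := by
  rw [gen, gen, Set.image_image]

theorem DepthTower.castLE (T : DepthTower σ K t lev) {i : ℕ} (h : i ≤ n) :
    DepthTower σ K (fun k => t (Fin.castLE h k)) (fun k => lev (Fin.castLE h k)) where
  stable := T.stable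
  const_mem := T.const_mem
  lev_pos j := T.lev_pos _
  transcendental j := by
    refine transcendental_mono ?_ (T.transcendental (Fin.castLE h j))
    exact gen_le le_gen fun a ha => mem_gen (show Fin.castLE h a < Fin.castLE h j from ha)
  sum_or_prod j := by
    have hle : gen K t {b | b < Fin.castLE h j ∧ lev b < lev (Fin.castLE h j)} ≤
        gen K (fun k => t (Fin.castLE h k))
          {b | b < j ∧ lev (Fin.castLE h b) < lev (Fin.castLE h j)} := by
      rw [← gen_image (K := K) (t := t) (Fin.castLE h)]
      refine gen_mono fun b hb => ?_
      exact ⟨⟨b, lt_trans (show (b : ℕ) < j from hb.1) j.2⟩, ⟨hb.1, hb.2⟩, rfl⟩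
    rcases T.sum_or_prod (Fin.castLE h j) with h1 | ⟨α, hα, h1⟩
    · exact Or.inl (hle h1)
    · exact Or.inr ⟨α, hle hα, h1⟩

theorem DepthTower.snoc (T : DepthTower σ K t lev) {x : F} {k : ℕ} (hk : 0 < k)
    (hx : Transcendental (gen K t Set.univ) x) (hΔ : σ x - x ∈ gen K t {b | lev b < k}) :
    DepthTower σ K (Fin.snoc t x : Fin (n + 1) → F) (Fin.snoc lev k : Fin (n + 1) → ℕ) := by
  have hgen : ∀ A, gen K (Fin.snoc t x : Fin (n + 1) → F) (Fin.castSucc '' A) = gen K t A := by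
    intro A
    rw [gen_image]
    simp
  refine ⟨T.stable, T.const_mem, fun j => ?_, fun j => ?_, fun j => ?_⟩
  · refine Fin.lastCases ?_ (fun j => ?_) j
    · simpa using hk
    · simpa using T.lev_pos j
  · refine Fin.lastCases ?_ (fun j => ?_) j
    · rw [Fin.snoc_last]
      refine transcendental_mono ?_ hx
      rw [← hgen]
      refine gen_mono fun b hb => ?_
      exact ⟨b.castPred (ne_of_lt hb), trivial, Fin.castSucc_castPred _ _⟩
    · rw [Fin.snoc_castSucc]
      refine transcendental_mono ?_ (T.transcendental j)
      rw [← hgen]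
      refine gen_mono fun b hb => ?_
      refine ⟨b.castPred (ne_of_lt (lt_trans hb (Fin.castSucc_lt_last j))), ?_,
        Fin.castSucc_castPred _ _⟩
      exact hb
  · refine Fin.lastCases ?_ (fun j => ?_) j
    · left
      rw [← hgen] at hΔ
      simp only [Fin.snoc_last]
      refine gen_mono ?_ hΔ
      rintro _ ⟨b, hb, rfl⟩
      refine And.intro (Fin.castSucc_lt_last b) ?_
      simpa using hb
    · have hle : gen K t {b | b < j ∧ lev b < lev j} ≤ gen K (Fin.snoc t x : Fin (n + 1) → F)
          {b | b < j.castSucc ∧ (Fin.snoc lev k : Fin (n + 1) → ℕ) b <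
            (Fin.snoc lev k : Fin (n + 1) → ℕ) j.castSucc} := by
        rw [← hgen]
        refine gen_mono ?_
        rintro _ ⟨b, hb, rfl⟩
        refine And.intro hb.1 ?_
        simpa using hb.2
      simp only [Fin.snoc_castSucc] at hle ⊢
      rcases T.sum_or_prod j with h1 | ⟨α, hα, h1⟩
      · exact Or.inl (hle h1)
      · exact Or.inr ⟨α, hle hα, h1⟩

theorem stable_allGen {i m : ℕ} {l : List (F × ℕ)} (T : DepthTower σ K t lev)
    (h : GoodList σ K t lev i m l) : Stable σ (allGen K t i l) := by
  refine sup_le (fun x hx => (le_sup_left : _ ≤ allGen K t i l) ?_)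
    (Subfield.closure_le.2 ?_)
  · refine T.stable_gen ?_ hx
    exact fun a ha b hb _ => lt_trans (show (b : ℕ) < a from hb) ha
  · rintro s ⟨k, hs⟩
    obtain ⟨k', -, -, h1⟩ := h.sub_mem_lowGen hs
    have h2 := add_mem (lowGen_le_allGen k' h1) ((le_sup_right : _ ≤ allGen K t i l)
      (Subfield.subset_closure ⟨k, hs⟩))
    rwa [sub_add_cancel] at h2

/-- A good list of sums, as a tuple that extends the tower of the first `i` generators. -/
theorem GoodList.exists_tuple [CharZero F] {i m : ℕ} {l : List (F × ℕ)} (T : DepthTower σ K t lev)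
    (hin : i ≤ n) (hi : ∀ j : Fin n, (j : ℕ) < i → ¬ IsRedundant σ K t lev j)
    (h : GoodList σ K t lev i m l) : ∃ (r : ℕ) (s : Fin r → F) (ls : Fin r → ℕ),
      DepthTower σ K (Fin.append (fun k => t (Fin.castLE hin k)) s)
        (Fin.append (fun k => lev (Fin.castLE hin k)) ls) ∧
      (∀ j, ls j ≤ m) ∧
      (∀ j, σ (s j) - s j ∈ gen K t {b | (b : ℕ) < i} ⊔ Subfield.closure (s '' {b | b < j})) ∧
      ∀ x k, (x, k) ∈ l ↔ ∃ j, s j = x ∧ ls j = k := by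
  induction h with
  | nil =>
    refine ⟨0, Fin.elim0, Fin.elim0, ?_, fun j => j.elim0, fun j => j.elim0, fun x k => ?_⟩
    · rw [Fin.append_elim0, Fin.append_elim0]
      exact T.castLE hin
    · simp
  | @cons x k l hl hk hb hbV ih =>
    obtain ⟨r, s, ls, hT, hls, hsum, hmem⟩ := ih
    have hall : gen K t {b | (b : ℕ) < i} ⊔ Subfield.closure (s '' Set.univ) = allGen K t i l := by
      rw [allGen]
      congr 2
      ext y
      simp only [Set.image_univ, Set.mem_range, Set.mem_ofPred_eq, hmem]
      exact ⟨fun ⟨j, hj⟩ => ⟨ls j, j, hj, rfl⟩, fun ⟨_, j, hj, _⟩ => ⟨j, hj⟩⟩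
    refine ⟨r + 1, Fin.snoc s x, Fin.snoc ls (k + 1), ?_, fun j => ?_, fun j => ?_,
      fun y k' => ?_⟩
    · rw [Fin.append_snoc, Fin.append_snoc]
      refine hT.snoc (Nat.succ_pos k) ?_ ?_
      · refine transcendental_mono (M := allGen K t i l) ?_
          (transcendental_of_sub_mem (stable_allGen T hl)
            (fun c hc => (le_gen.trans le_sup_left : K ≤ allGen K t i l) (T.const_mem c hc))
            (hl.not_mem_allGen T hin hi hb hbV) (lowGen_le_allGen k hb))
        refine gen_le (le_gen.trans le_sup_left) fun a _ => ?_
        refine Fin.addCases (fun a => ?_) (fun a => ?_) a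
        · rw [Fin.append_left]
          exact (le_sup_left : _ ≤ allGen K t i l) (mem_gen (show (a : ℕ) < i from a.2))
        · rw [Fin.append_right]
          exact (le_sup_right : _ ≤ allGen K t i l)
            (Subfield.subset_closure ⟨ls a, (hmem _ _).2 ⟨a, rfl, rfl⟩⟩)
      · refine (sup_le (gen_le le_gen fun a ha => ?_) (Subfield.closure_le.2 ?_) :
          lowGen K t lev i k l ≤ _) hb
        · have h1 : t a = Fin.append (fun k => t (Fin.castLE hin k)) s
              (Fin.castAdd r ⟨a, ha.1⟩) := by
            rw [Fin.append_left]; rfl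
          rw [h1]
          refine mem_gen ?_
          rw [Set.mem_ofPred_eq, Fin.append_left]
          exact Nat.lt_succ_of_le ha.2
        · rintro y ⟨k', hk', hy⟩
          obtain ⟨j, rfl, rfl⟩ := (hmem _ _).1 hy
          have h1 : s j = Fin.append (fun k => t (Fin.castLE hin k)) s (Fin.natAdd i j) := by
            rw [Fin.append_right]
          rw [h1]
          refine mem_gen ?_
          rw [Set.mem_ofPred_eq, Fin.append_right]
          exact Nat.lt_succ_of_le hk'
    · refine Fin.lastCases ?_ (fun j => ?_) j
      · rw [Fin.snoc_last]; exact hk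
      · rw [Fin.snoc_castSucc]; exact hls j
    · refine Fin.lastCases ?_ (fun j => ?_) j
      · rw [Fin.snoc_last]
        refine (hall.ge.trans (sup_le_sup_left (Subfield.closure_mono ?_) _))
          (lowGen_le_allGen k hb)
        rintro _ ⟨b, -, rfl⟩
        exact ⟨b.castSucc, Fin.castSucc_lt_last b, by rw [Fin.snoc_castSucc]⟩
      · rw [Fin.snoc_castSucc]
        refine sup_le_sup_left (Subfield.closure_mono ?_) _ (hsum j)
        rintro _ ⟨b, hb, rfl⟩
        exact ⟨b.castSucc, hb, by rw [Fin.snoc_castSucc]⟩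
    · rw [List.mem_cons, hmem, Fin.exists_fin_succ']
      simp only [Fin.snoc_castSucc, Fin.snoc_last, Prod.mk.injEq]
      rw [or_comm, eq_comm (a := y), eq_comm (a := k')]

/-- Solving for the inverse image gives σ⁻¹(t) = t - σ⁻¹(a) for a sum and t/σ⁻¹(α) for a product. It
ensures that σ restricts to an automorphism of such a field. -/
theorem DepthTower.symm_mem (T : DepthTower σ K t lev) (hK : ∀ x ∈ K, σ.symm x ∈ K)
    {A : Set (Fin n)} (hA : ∀ a ∈ A, ∀ b < a, b ∈ A) {x : F} (hx : x ∈ gen K t A) :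
    σ.symm x ∈ gen K t A := by
  have hle : ∀ B : Set (Fin n), (∀ b ∈ B, σ.symm (t b) ∈ gen K t A) → ∀ y ∈ gen K t B,
      σ.symm y ∈ gen K t A := fun B hB y hy =>
    (gen_le (fun z hz => le_gen (hK z hz)) hB :
      gen K t B ≤ (gen K t A).comap (σ.symm : F →+* F)) hy
  refine hle A (fun a => ?_) x hx
  induction a using WellFoundedLT.induction with
  | ind a ih =>
    intro ha
    have hlow := hle {b | b < a ∧ lev b < lev a} fun b hb => ih b hb.1 (hA a ha b hb.1)
    rcases T.sum_or_prod a with h | ⟨α, hα, h⟩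
    · have h1 := sub_mem (mem_gen (K := K) (t := t) ha) (hlow _ h)
      rwa [map_sub, σ.symm_apply_apply, sub_sub_cancel] at h1
    · have h0 : σ.symm α ≠ 0 := by
        intro h0
        have : σ (t a) = 0 := by rw [h, (map_eq_zero _).1 h0, zero_mul]
        exact T.ne_zero a ((map_eq_zero _).1 this)
      have h1 : t a = σ.symm α * σ.symm (t a) := by rw [← map_mul, ← h, σ.symm_apply_apply]
      have h2 := div_mem (mem_gen (K := K) (t := t) ha) (hlow _ hα)
      rwa [h1, mul_div_cancel_left₀ _ h0] at h2

end Tuples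

end DiffField

namespace DiffField

/-! ### Depth-optimality excludes redundancy -/

section Main

variable {G : Type u} {F : Type v} [Field G] [Field F] [Algebra G F] {σG : G ≃+* G} {σ : F ≃+* F}
  {n : ℕ} {t : Fin n → F}

/-- The restriction of `σ` to a subfield that is closed under `σ` and its inverse. -/
def restrictEquiv {S : Type*} [SetLike S F] [SubringClass S F] (σ : F ≃+* F) (E : S)
    (h : ∀ x ∈ E, σ x ∈ E) (h' : ∀ x ∈ E, σ.symm x ∈ E) : E ≃+* E where
  toFun x := ⟨σ x, h x x.2⟩
  invFun x := ⟨σ.symm x, h' x x.2⟩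
  left_inv _ := Subtype.ext (σ.symm_apply_apply _)
  right_inv _ := Subtype.ext (σ.apply_symm_apply _)
  map_mul' _ _ := Subtype.ext (map_mul σ _ _)
  map_add' _ _ := Subtype.ext (map_add σ _ _)

theorem IsPiSigmaExt.const_mem (h : IsPiSigmaExt σG σ t) {c : F} (hc : σ c = c) :
    c ∈ (algebraMap G F).fieldRange := by
  have key : ∀ k : ℕ, k ≤ n → c ∈ stage G t k → c ∈ stage G t 0 := by
    intro k
    induction k with
    | zero => exact fun _ h => h
    | succ k ih =>
      intro hk hck
      refine ih (by omega) ?_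
      have h1 : c ∈ IntermediateField.adjoin (stage G t k) {t ⟨k, hk⟩} := by
        refine map_mem_of_mem_adjoin (G := G) (RingHom.id F)
          (M := (IntermediateField.adjoin (stage G t k) {t ⟨k, hk⟩}).toSubfield)
          (fun d => ?_) ?_ hck
        · exact (IntermediateField.adjoin (stage G t k) {t ⟨k, hk⟩}).algebraMap_mem
            (algebraMap G _ d)
        · rintro _ ⟨b, hb, rfl⟩
          rcases (Nat.lt_succ_iff.1 hb).lt_or_eq with hb | hb
          · exact (IntermediateField.adjoin (stage G t k) {t ⟨k, hk⟩}).algebraMap_mem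
              ⟨t b, IntermediateField.subset_adjoin G _ ⟨b, hb, rfl⟩⟩
          · have : b = ⟨k, hk⟩ := Fin.ext hb
            exact IntermediateField.subset_adjoin _ _ (by rw [this]; rfl)
      rcases h.isGen ⟨k, hk⟩ with h2 | h2
      · exact h2.2.2 c h1 hc
      · exact h2.2.2 c h1 hc
  have h0 := key n le_rfl (by rw [h.stage_eq_top]; trivial)
  have h1 : stage G t 0 = ⊥ := by simp [stage]
  rw [h1, IntermediateField.mem_bot] at h0
  exact h0

theorem IsPiSigmaExt.transcendental (h : IsPiSigmaExt σG σ t) (j : Fin n) :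
    Transcendental (stage G t j) (t j) := by
  rcases h.isGen j with h | h <;> exact h.1

theorem IsPiSigmaExt.adjoin_eq_top (h : IsPiSigmaExt σG σ t) :
    IntermediateField.adjoin G (t '' Set.univ) = ⊤ := by
  rw [← h.stage_eq_top, stage]
  congr 2
  ext j
  simp

theorem mem_stage_iff {i : ℕ} {x : F} : x ∈ stage G t i ↔
    x ∈ gen (algebraMap G F).fieldRange t {b | (b : ℕ) < i} :=
  mem_gen_fieldRange_iff.symm

/-- A coefficient lies in the field generated by the variables that occur in it, and these precede
its generator and have smaller depth. So the depths themselves serve as levels. -/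
theorem IsPiSigmaExt.depthTower (h : IsPiSigmaExt σG σ t) :
    DepthTower σ (algebraMap G F).fieldRange t (genDepth G σ t) := by
  have htr : ∀ j : Fin n, Transcendental (gen (algebraMap G F).fieldRange t {b | b < j}) (t j) := by
    intro j hj
    have hle : ∀ x : gen (algebraMap G F).fieldRange t {b | b < j}, (x : F) ∈ stage G t j :=
      fun x => mem_stage_iff.2 x.2
    let f : gen (algebraMap G F).fieldRange t {b | b < j} →+* stage G t j :=
      (Subfield.subtype _).codRestrict (stage G t j) hle
    exact h.transcendental j (hj.ringHom_of_comp_eq f (RingHom.id F) f.injective rfl)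
  have ht : AlgebraicIndependent G t := by
    refine algebraicIndependent_of_transcendental_lt fun j hj => h.transcendental j ?_
    have hle : ∀ x : Algebra.adjoin G (t '' {b | b < j}), (x : F) ∈ stage G t j :=
      fun x => IntermediateField.algebra_adjoin_le_adjoin G _ x.2
    let f : Algebra.adjoin G (t '' {b | b < j}) →+* stage G t j :=
      ((Algebra.adjoin G (t '' {b | b < j})).val : _ →+* F).codRestrict (stage G t j) hle
    refine hj.ringHom_of_comp_eq f (RingHom.id F) ?_ rfl
    exact fun x y hxy => Subtype.ext (congrArg (Subtype.val : stage G t j → F) hxy)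
  have hlow : ∀ j : Fin n, shiftCoeff σ (stage G t j) (t j) ∈ stage G t j →
      shiftCoeff σ (stage G t j) (t j) ∈ gen (algebraMap G F).fieldRange t
        {b | b < j ∧ genDepth G σ t b < genDepth G σ t j} := by
    intro j hj
    have hocc : ∀ b, Occurs G t (shiftCoeff σ (stage G t j) (t j)) b → b < j :=
      fun b hb => Occurs.mem ht hj hb
    have h1 := mem_adjoin_occurs (t := t) (x := shiftCoeff σ (stage G t j) (t j))
      (by rw [h.adjoin_eq_top]; trivial)
    exact gen_mono (fun b hb => And.intro (hocc b hb) (genDepth_lt (hocc b hb) hb))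
      (mem_gen_fieldRange_iff.2 h1)
  have hconst : ∀ (j : Fin n) c, σ c = c → c ∈ stage G t j := fun j c hc =>
    mem_stage_iff.2 (le_gen (h.const_mem hc))
  refine ⟨?_, fun c hc => h.const_mem hc, fun j => genDepth_pos j, htr, fun j => ?_⟩
  · rintro _ ⟨c, rfl⟩
    exact ⟨σG c, (h.extends_aut c).symm⟩
  · rcases h.isGen j with ⟨htj, ⟨a, ha, -, haj⟩, -⟩ | ⟨-, ⟨a, ha, -, haj⟩, -⟩
    · right
      have h1 : t j ∉ stage G t j := fun hmem => htj
        (isAlgebraic_algebraMap (⟨t j, hmem⟩ : stage G t j))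
      have h2 := shiftCoeff_of_prod (hconst j) h1 ha haj
      have h3 := hlow j (by rwa [h2])
      rw [h2] at h3
      exact ⟨a, h3, haj⟩
    · left
      have h1 : σ (t j) - t j = a := by rw [haj, add_sub_cancel_left]
      have h2 := shiftCoeff_of_sum (σ := σ) (L := stage G t j) (x := t j) (by rwa [h1])
      rw [← h2]
      refine hlow j ?_
      rwa [h2, h1]

theorem IsPiSigmaExt.depth_le_iff (h : IsPiSigmaExt σG σ t) {x : F} {k : ℕ} :
    depth G σ t x ≤ k ↔ x ∈ gen (algebraMap G F).fieldRange t {j | genDepth G σ t j ≤ k} := by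
  rw [DiffField.depth_le_iff (h.depthTower.algebraicIndependent fun c => ⟨c, rfl⟩)
    h.adjoin_eq_top, mem_gen_fieldRange_iff]

theorem IsPiSigmaDeltaExt.not_isRedundant [CharZero G] (h : IsPiSigmaDeltaExt σG σ t) (i : Fin n) :
    ¬ IsRedundant σ (algebraMap G F).fieldRange t (genDepth G σ t) i := by
  have hF : IsPiSigmaExt σG σ t := h.toIsPiSigmaExt
  have : CharZero F := charZero_of_injective_algebraMap (algebraMap G F).injective
  set K := (algebraMap G F).fieldRange with hK
  have T : DepthTower σ K t (genDepth G σ t) := hF.depthTower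
  have hKsymm : ∀ x ∈ K, σ.symm x ∈ K := by
    rintro _ ⟨c, rfl⟩
    refine ⟨σG.symm c, ?_⟩
    rw [RingEquiv.eq_symm_apply, hF.extends_aut, σG.apply_symm_apply]
  induction i using WellFoundedLT.induction with
  | ind i ih =>
    intro hi
    obtain ⟨l, hl, htl⟩ := hi.exists_goodList
    have hin : (i : ℕ) ≤ n := i.isLt.le
    -- The induction hypothesis makes the sums in the list algebraically independent over the stage.
    obtain ⟨r, s, ls, T', hls, hsum, hmem⟩ := hl.exists_tuple T hin fun j hj => ih j hj
    set L := stage G t i with hL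
    set U : Fin (i + r) → F := Fin.append (fun k => t (Fin.castLE hin k)) s with hU
    have hstage : ∀ x, x ∈ L ↔ x ∈ gen K t {b | (b : ℕ) < i} := fun x => mem_stage_iff
    have hdown : DownClosed (genDepth G σ t) {b : Fin n | (b : ℕ) < i} :=
      fun a ha b hb _ => lt_trans (show (b : ℕ) < a from hb) ha
    have hLσ : ∀ x ∈ L, σ x ∈ L := fun x hx => (hstage _).2 (T.stable_gen hdown ((hstage x).1 hx))
    have hLσ' : ∀ x ∈ L, σ.symm x ∈ L := fun x hx => (hstage _).2 (T.symm_mem hKsymm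
      (fun a ha b hb => lt_trans (show (b : ℕ) < a from hb) ha) ((hstage x).1 hx))
    have hti : σ (t i) - t i ∈ L := (hstage _).2 (gen_mono (fun b hb => hb.1) hi.1)
    -- The extension excluded by depth-optimality is realized inside F, with the restriction of σ as
    -- its automorphism and t_i itself as the solution.
    let E := IntermediateField.adjoin L (Set.range s)
    have hLU : ∀ (A : Set (Fin (i + r))), (∀ k : Fin i, Fin.castAdd r k ∈ A) →
        ∀ x ∈ L, x ∈ gen K U A := by
      intro A hA x hx
      refine (gen_le le_gen fun b hb => ?_ : gen K t {b | (b : ℕ) < i} ≤ gen K U A)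
        ((hstage x).1 hx)
      have h1 : t b = U (Fin.castAdd r ⟨b, hb⟩) := by rw [hU, Fin.append_left]; rfl
      rw [h1]
      exact mem_gen (hA _)
    have hUadj : ∀ (A : Set (Fin r)) (B : Set (Fin (i + r))),
        (∀ k, Fin.natAdd (i : ℕ) k ∈ B → k ∈ A) →
        ∀ x ∈ gen K U B, x ∈ IntermediateField.adjoin L (s '' A) := by
      intro A B hAB x hx
      refine (gen_le ?_ ?_ : gen K U B ≤ (IntermediateField.adjoin L (s '' A)).toSubfield) hx
      · rintro _ ⟨c, rfl⟩
        exact (IntermediateField.adjoin L (s '' A)).algebraMap_mem (algebraMap G L c)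
      · intro b
        refine Fin.addCases (fun b hb => ?_) (fun b hb => ?_) b
        · rw [hU, Fin.append_left]
          exact (IntermediateField.adjoin L (s '' A)).algebraMap_mem (lowerGens G t i b)
        · rw [hU, Fin.append_right]
          exact IntermediateField.subset_adjoin _ _ ⟨b, hAB b hb, rfl⟩
    have hE : ∀ x, x ∈ E ↔ x ∈ gen K U Set.univ := by
      intro x
      constructor
      · intro hx
        refine map_mem_of_mem_adjoin (G := L) (RingHom.id F) (M := gen K U Set.univ)
          (fun c => hLU Set.univ (fun _ => trivial) _ c.2) ?_ hx
        rintro _ ⟨j, rfl⟩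
        have h1 : s j = U (Fin.natAdd i j) := by rw [hU, Fin.append_right]
        rw [RingHom.id_apply, h1]
        exact mem_gen trivial
      · intro hx
        have := hUadj Set.univ Set.univ (fun _ _ => trivial) x hx
        rwa [Set.image_univ] at this
    have hEσ : ∀ x ∈ E, σ x ∈ E := fun x hx =>
      (hE _).2 (T'.stable_gen (fun _ _ _ _ _ => trivial) ((hE x).1 hx))
    have hEσ' : ∀ x ∈ E, σ.symm x ∈ E := fun x hx =>
      (hE _).2 (T'.symm_mem hKsymm (fun _ _ _ _ => trivial) ((hE x).1 hx))
    let τ := restrictEquiv σ L hLσ hLσ'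
    let σE := restrictEquiv σ E hEσ hEσ'
    let sE : Fin r → E := fun j => ⟨s j, IntermediateField.subset_adjoin _ _ ⟨j, rfl⟩⟩
    have hsE : ∀ A : Set (Fin r), E.val '' (sE '' A) = s '' A := fun A => by
      rw [Set.image_image]; rfl
    have hstageE : ∀ (k : ℕ) (x : E),
        (x : F) ∈ IntermediateField.adjoin L (s '' {j | (j : ℕ) < k}) →
        x ∈ stage L sE k := by
      intro k x hx
      refine mem_adjoin_of_map_mem E.val ?_
      rw [hsE]
      exact hx
    have hsub : ∀ j, σ (s j) - s j ∈ IntermediateField.adjoin L (s '' {b | b < j}) := by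
      intro j
      refine (sup_le (fun x hx => ?_) (Subfield.closure_le.2 ?_) : _ ≤
        (IntermediateField.adjoin L (s '' {b | b < j})).toSubfield) (hsum j)
      · exact (IntermediateField.adjoin L (s '' {b | b < j})).algebraMap_mem ⟨x, (hstage x).2 hx⟩
      · exact IntermediateField.subset_adjoin _ _
    have hconst : ∀ (k : ℕ) (c : E), σE c = c → c ∈ stage L sE k := by
      intro k c hc
      obtain ⟨d, hd⟩ := T.const_mem (c : F) (congrArg Subtype.val hc)
      have h1 : c = algebraMap L E (algebraMap G L d) := Subtype.ext hd.symm
      rw [h1]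
      exact (stage L sE k).algebraMap_mem _
    have htr : ∀ j : Fin r, Transcendental (stage L sE j) (sE j) := by
      intro j hj
      have hmap : ∀ x : stage L sE j, ((x : E) : F) ∈ gen K U {b | b < Fin.natAdd i j} := by
        intro x
        refine map_mem_of_mem_adjoin (G := L) (E.val : E →+* F)
          (M := gen K U {b | b < Fin.natAdd i j}) (fun c => hLU _ (fun k => ?_) _ c.2) ?_ x.2
        · exact lt_of_lt_of_le (show (k : ℕ) < i from k.2) (Nat.le_add_right (i : ℕ) j)
        · rintro _ ⟨b, hb, rfl⟩
          have h1 : (E.val : E →+* F) (sE b) = U (Fin.natAdd i b) := by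
            rw [hU, Fin.append_right]; rfl
          rw [h1]
          exact mem_gen (Nat.add_lt_add_left (show (b : ℕ) < j from hb) (i : ℕ))
      let f : stage L sE j →+* gen K U {b | b < Fin.natAdd i j} :=
        ((E.val : E →+* F).comp (stage L sE j).val.toRingHom).codRestrict _ hmap
      have h1 := T'.transcendental (Fin.natAdd i j)
      rw [hU, Fin.append_right, ← hU] at h1
      exact h1 (hj.ringHom_of_comp_eq f (E.val : E →+* F) f.injective rfl)
    have hσext : IsSigmaExt τ σE sE := by
      refine ⟨fun c => rfl, ?_, fun j => ⟨htr j, ?_, fun c _ hc => hconst j c hc⟩⟩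
      · refine eq_top_iff.2 fun x _ => hstageE r x ?_
        have h1 : {j : Fin r | (j : ℕ) < r} = Set.univ := by ext j; simp
        rw [h1, Set.image_univ]
        exact x.2
      · refine ⟨σE (sE j) - sE j, hstageE j _ (hsub j), fun h0 => ?_, by ring⟩
        exact htr j (isAlgebraic_algebraMap
          (⟨sE j, hconst j _ (sub_eq_zero.1 h0)⟩ : stage L sE j))
    have hsigma : IsSigmaGen σ L (t i) := by
      refine ⟨hF.transcendental i, ⟨σ (t i) - t i, hti, fun h0 => ?_, by ring⟩, ?_⟩
      · exact hF.transcendental i (isAlgebraic_algebraMap (⟨t i, (hstage _).2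
          (le_gen (T.const_mem _ (sub_eq_zero.1 h0)))⟩ : stage G t i))
      · exact fun c _ hc => (hstage c).2 (le_gen (T.const_mem c hc))
    have htE : t i ∈ E := by
      refine (sup_le (fun x hx => ?_) (Subfield.closure_le.2 ?_) :
        allGen K t i l ≤ E.toSubfield) htl
      · exact E.algebraMap_mem ⟨x, (hstage x).2 hx⟩
      · rintro x ⟨k, hx⟩
        obtain ⟨j, rfl, -⟩ := (hmem _ _).1 hx
        exact (sE j).2
    refine h.depthOptimal i hsigma ⟨σ (t i) - t i, hti⟩ (by ring) ⟨E, inferInstance, inferInstance,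
      inferInstance, inferInstance, τ, σE, r, sE, fun x => rfl, hσext, fun j => ?_, ⟨t i, htE⟩,
      Subtype.ext rfl⟩
    let ι : E →ₐ[G] F := E.val.restrictScalars G
    have hUE :
        (fun j => ι (Fin.append (fun k => algebraMap L E (lowerGens G t i k)) sE j)) = U := by
      funext b
      refine Fin.addCases (fun b => ?_) (fun b => ?_) b
      · rw [hU, Fin.append_left, Fin.append_left]; rfl
      · rw [hU, Fin.append_right, Fin.append_right]; rfl
    have h1 := DepthTower.genDepth_le
      (t := Fin.append (fun k => algebraMap L E (lowerGens G t i k)) sE) ι (σE := σE)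
      (fun x => rfl) (by rw [hUE]; exact T') (Fin.natAdd i j)
    rw [Fin.append_right] at h1
    -- The sums have level at most the depth of t_i minus one, which is at most the depth of its
    -- coefficient.
    have h2 := genDepth_le_depth_shiftCoeff (G := G) (σ := σ) (t := t) i
    rw [shiftCoeff_of_sum hti] at h2
    have h3 := hls j
    change _ ≤ depth G σ t (σ (t i) - t i)
    exact h1.trans (by omega)

end Main

end DiffField

theorem mainTheorem7 {G : Type u} {F : Type v} [Field G] [CharZero G] [Field F] [Algebra G F]
    (σG : G ≃+* G) (σ : F ≃+* F) {n : ℕ} (t : Fin n → F)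
    (hF : DiffField.IsPiSigmaDeltaExt σG σ t)
    (f g : F) (hfg : σ g - g = f) :
    DiffField.depth G σ t f ≤ DiffField.depth G σ t g ∧
      DiffField.depth G σ t g ≤ DiffField.depth G σ t f + 1 := by
  have : CharZero F := charZero_of_injective_algebraMap (algebraMap G F).injective
  have hP := hF.toIsPiSigmaExt
  have T := hP.depthTower
  constructor
  · rw [hP.depth_le_iff, ← hfg]
    refine DiffField.Stable.sub_mem (T.stable_gen ?_) (hP.depth_le_iff.1 le_rfl)
    exact fun a ha b _ hb => hb.le.trans ha
  · rw [hP.depth_le_iff]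
    refine T.mem_gen_of_sub_mem hF.not_isRedundant ?_ ?_
    · rw [DiffField.mem_gen_fieldRange_iff, hP.adjoin_eq_top]
      trivial
    · rw [hfg]
      exact hP.depth_le_iff.1 le_rfl
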